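/- Let $F$ be a nonarchimedean local field with ring of integers $\mathcal O$ and uniformizer $\varpi$, let $d\ge 2$, $G=PGL_d(F)$, and let $K=PGL_d(\mathcal O)$ be the image of $GL_d(\mathcal O)$ in $G$. Let $\mathcal B$ be the Bruhat–Tits building of $G$: its vertex set is $\mathcal B^0=G/K$, where $\xi$ denotes the coset $K$ and $g\xi$ corresponds to the homothety class of the lattice $g\mathcal O^d\subset F^d$; a set of vertices is an $r$-cell if it can be written $\{g_0\xi,\dots,g_r\xi\}$ with $g_i\in GL_d(F)$ such that $\varpi g_0\mathcal O^d\subsetneq g_r\mathcal O^d\subsetneq\dots\subsetneq g_1\mathcal O^d\subsetneq g_0\mathcal O^d$. The color of a vertex is $\mathrm{col}(g\xi)=\mathrm{ord}_\varpi\det g\in\mathbb Z/d\mathbb Z$. For $0\le j\le d-1$, $\mathcal B_1^j$ is the set of ordered $j$-cells $[v_0,\dots,v_j]$ of type one, i.e. with $\mathrm{col}(v_{i+1})=\mathrm{col}(v_i)+1$ for $0\le i<j$; we identify $\mathcal B_1^0=\mathcal B^0$. A branching operator $T:\Omega_1\to\Omega_2$ is a map $\Omega_1\to 2^{\Omega_2}$;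 these are composed by $(T\circ S)(a)=\bigcup_{b\in S(a)}T(b)$, and powers are iterated compositions. Consider the following branching operators. * For $1\le j\le d-1$, the geodesic $j$-flow $T_j:\mathcal B_1^j\to\mathcal B_1^j$ takes $[v_0,\dots,v_j]$ to all $[v_1,\dots,v_j,w]\in\mathcal B_1^j$ such that $\{v_0,\dots,v_j,w\}$ is not a cell of $\mathcal B$. * For $0\le j\le d-2$, $T_{j,j+1}:\mathcal B_1^j\to\mathcal B_1^{j+1}$ takes $[v_0,\dots,v_j]$ to all $[v,v_0,\dots,v_j]\in\mathcal B_1^{j+1}$ with $v\in\mathcal B^0$. * $T_{d-1,0}:\mathcal B_1^{d-1}\to\mathcal B^0$ takes $[v_0,\dots,v_{d-1}]$ to $\{v_{d-1}\}$. For $\vec x=(x_1,\dots,x_{d-1})\in\mathbb N^{d-1}$ let $$T_{\vec x}=T_{d-1,0}\,\bigl(T_{d-1}^{(d-1)x_{d-1}}T_{d-2,d-1}\bigr)\cdots\bigl(T_2^{2x_2}T_{1,2}\bigr)\bigl(T_1^{x_1}T_{0,1}\bigr):\mathcal B^0\to\mathcal B^0,$$ where the rightmost factor acts first, and let $s(\vec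 x)=\mathrm{diag}(\varpi^{\alpha_1},\dots,\varpi^{\alpha_d})\,\xi$ with $\alpha_i=x_i+\dots+x_{d-1}$ (so $\alpha_d=0$). Then: 1. (Cartan decomposition) The map $\mathbb N^{d-1}\to K\backslash\mathcal B^0$, $\vec x\mapsto K s(\vec x)$, is a bijection. Let $\Phi:\mathcal B^0\to\mathbb N^{d-1}$ (the Cartan projection) be the composition of the projection $\mathcal B^0\to K\backslash\mathcal B^0$ with its inverse. 2. For every $\vec x\in\mathbb N^{d-1}$, the fiber $\Phi^{-1}(\vec x)$ equals $T_{\vec x}(\xi)$. 3. All of these operators are Hecke operators of double cosets. Precisely, let $\xi_i=\mathrm{diag}(1,\dots,1,\varpi,\dots,\varpi)\,\xi$ with $i$ entries $1$ and $d-i$ entries $\varpi$, let $\sigma^j=[\xi_j,\xi_{j-1},\dots,\xi_0]$ and let $P_j=G_{\sigma^j}$ be its stabilizer in $G$ (so $\xi_0=\xi$, $P_0=K$). Then $\mathcal B_1^j=G\sigma^j$ for $0\le j\le d-1$. A double coset $P_i\,g\,P_k$ defines the branching operator $\mathcal B_1^i\to\mathcal B_1^k$, $g'\sigma^i\mapsto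 g'P_i\,g\,\sigma^k$. With this, $T_j=P_jw_jP_j$ for $1\le j\le d-1$, where $$w_j=\begin{pmatrix}0&I_{j-1}&0\\ \varpi&0&0\\ 0&0&I_{d-j}\end{pmatrix},$$ $T_{j,j+1}=P_jP_{j+1}$ for $0\le j\le d-2$, and $T_{d-1,0}=P_{d-1}P_0$. -/

import Mathlib

open ValuativeRel
open scoped Pointwise

namespace BruhatTits

noncomputable section

/-! ### Branching operators and Hecke operators -/

/-- A branching operator from `Ω₁` to `Ω₂` is a map `Ω₁ → 2^Ω₂`. -/
abbrev Branching (Ω₁ Ω₂ : Type*) := Ω₁ → Set Ω₂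

namespace Branching

variable {Ω₁ Ω₂ Ω₃ Ω : Type*}

/-- The composition `T ∘ S` of branching operators: first `S`, then `T`. -/
def comp (T : Branching Ω₂ Ω₃) (S : Branching Ω₁ Ω₂) : Branching Ω₁ Ω₃ :=
  fun a => ⋃ b ∈ S a, T b

/-- The powers `T ^ n` of a branching operator with respect to composition. -/
def pow (T : Branching Ω Ω) : ℕ → Branching Ω Ω
  | 0 => fun a => {a}
  | n + 1 => comp T (pow T n)

end Branching

/-- The Hecke operator of the double coset `G_a g G_b`, where `G_a`, `G_b` are the stabilizers of
`a` and `b`: it maps a point `g' a` of the orbit of `a` to `g' G_a g b`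
(and points outside the orbit of `a`, if there are any, to the empty set). -/
def hecke {G Ω₁ Ω₂ : Type*} [Group G] [MulAction G Ω₁] [MulAction G Ω₂]
    (a : Ω₁) (g : G) (b : Ω₂) : Branching Ω₁ Ω₂ :=
  fun s => {t | ∃ g' : G, s = g' • a ∧ ∃ p ∈ MulAction.stabilizer G a, t = (g' * p * g) • b}

/-! ### The group `PGL_d(F)`, its maximal compact subgroup, and the vertices of the building -/

section Field

variable (F : Type*) [Field F] [ValuativeRel F]

/-- `PGL_d(F)`. -/
abbrev PGL (d : ℕ) : Type _ :=
  Matrix.GeneralLinearGroup (Fin d) F ⧸ Subgroup.center (Matrix.GeneralLinearGroup (Fin d) F)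

/-- `K = PGL_d(𝒪)`, the image of `GL_d(𝒪)` in `PGL_d(F)`. -/
def maxCompact (d : ℕ) : Subgroup (PGL F d) :=
  ((QuotientGroup.mk' (Subgroup.center (Matrix.GeneralLinearGroup (Fin d) F))).comp
    (Matrix.GeneralLinearGroup.map (algebraMap 𝒪[F] F))).range

/-- The vertices of the building, as left `K`-cosets in `G = PGL_d(F)`. -/
abbrev Vertex (d : ℕ) : Type _ := PGL F d ⧸ maxCompact F d

/-- The vertex `ξ`, whose stabilizer is `K`. -/
def xi (d : ℕ) : Vertex F d := ((1 : PGL F d) : Vertex F d)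

/-- The standard lattice `𝒪^d` in `F^d`. -/
def stdLattice (d : ℕ) : Submodule 𝒪[F] (Fin d → F) where
  carrier := {v | ∀ i, v i ∈ 𝒪[F]}
  add_mem' hv hw i := add_mem (hv i) (hw i)
  zero_mem' _ := zero_mem _
  smul_mem' c _ hv i := mul_mem c.2 (hv i)

variable {F}

/-- The class of a matrix in `PGL_d(F)`. -/
def toPGL {d : ℕ} (g : Matrix.GeneralLinearGroup (Fin d) F) : PGL F d := QuotientGroup.mk g

/-- The vertex `gξ`. -/
def vtx {d : ℕ} (g : Matrix.GeneralLinearGroup (Fin d) F) : Vertex F d := toPGL g • xi F d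

/-- The lattice `g 𝒪^d`. The vertex `gξ` corresponds to the homothety class of this lattice. -/
def lattice {d : ℕ} (g : Matrix.GeneralLinearGroup (Fin d) F) : Submodule 𝒪[F] (Fin d → F) :=
  (stdLattice F d).map ((Matrix.toLin' (g : Matrix (Fin d) (Fin d) F)).restrictScalars 𝒪[F])

lemma lattice_mul {d : ℕ} (h g : Matrix.GeneralLinearGroup (Fin d) F) :
    lattice (h * g) = (lattice g).map
      ((Matrix.toLin' (h : Matrix (Fin d) (Fin d) F)).restrictScalars 𝒪[F]) := by
  unfold lattice
  rw [← Submodule.map_comp]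
  congr 1
  ext v i
  simp

lemma mem_lattice {d : ℕ} {g : Matrix.GeneralLinearGroup (Fin d) F} {v : Fin d → F} :
    v ∈ lattice g ↔
      ∃ u ∈ stdLattice F d, (g : Matrix (Fin d) (Fin d) F).mulVec u = v := by
  simp [lattice, Submodule.mem_map]

lemma toLin_injective {d : ℕ} (h : Matrix.GeneralLinearGroup (Fin d) F) :
    Function.Injective
      ((Matrix.toLin' (h : Matrix (Fin d) (Fin d) F)).restrictScalars 𝒪[F]) := by
  intro v w hvw
  have : (h : Matrix (Fin d) (Fin d) F).mulVec v = (h : Matrix (Fin d) (Fin d) F).mulVec w := by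
    simpa using hvw
  exact Matrix.mulVec_injective_iff_isUnit.mpr ⟨h, rfl⟩ this

/-- The diagonal matrix with the given invertible diagonal entries. -/
def diag {d : ℕ} (a : Fin d → Fˣ) : Matrix.GeneralLinearGroup (Fin d) F where
  val := Matrix.diagonal fun i => (a i : F)
  inv := Matrix.diagonal fun i => ((a i)⁻¹ : Fˣ)
  val_inv := by simp [Matrix.diagonal_mul_diagonal]
  inv_val := by simp [Matrix.diagonal_mul_diagonal]

lemma mem_lattice_diag {d : ℕ} (a : Fin d → Fˣ) (v : Fin d → F) :
    v ∈ lattice (diag a) ↔ ∀ i, ((a i)⁻¹ : Fˣ) * v i ∈ 𝒪[F] := by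
  rw [mem_lattice]
  constructor
  · rintro ⟨u, hu, rfl⟩ i
    have := hu i
    simpa [diag, Matrix.mulVec_diagonal] using this
  · intro h
    refine ⟨fun i => ((a i)⁻¹ : Fˣ) * v i, h, ?_⟩
    ext i
    simp [diag, Matrix.mulVec_diagonal]

end Field

/-! ### The building of `PGL_d(F)` for a nonarchimedean local field `F` -/

section LocalField

set_option linter.unusedSectionVars false

variable {F : Type*} [Field F] [ValuativeRel F] [TopologicalSpace F] [IsNonarchimedeanLocalField F]

variable (F) in
/-- A uniformizer of `F`. -/
structure Uniformizer where
  /-- the underlying element of the ring of integers -/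
  val : 𝒪[F]
  irreducible : Irreducible val

/-- The uniformizer as a unit of the field. -/
def Uniformizer.unit (ϖ : Uniformizer F) : Fˣ :=
  Units.mk0 (ϖ.val : F) (by simpa using ϖ.irreducible.ne_zero)

/-- The normalized valuation `ord : F → ℤ` (with value `0` at `0`): the additive form of the
`𝔪`-adic valuation, `𝔪 = ϖ𝒪` being the maximal ideal. -/
def ord (x : F) : ℤ :=
  -WithZero.log ((IsDiscreteValuationRing.maximalIdeal 𝒪[F]).valuation F x)

lemma ord_mul {x y : F} (hx : x ≠ 0) (hy : y ≠ 0) : ord (x * y) = ord x + ord y := by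
  unfold ord
  rw [map_mul, WithZero.log_mul] <;> simp [hx, hy, add_comm]

lemma ord_one : ord (1 : F) = 0 := by simp [ord]

lemma ord_integral_unit (u : 𝒪[F]ˣ) : ord ((u : 𝒪[F]) : F) = 0 := by
  have h : (IsDiscreteValuationRing.maximalIdeal 𝒪[F]).valuation F
      (algebraMap 𝒪[F] F (u : 𝒪[F])) = 1 := by
    rw [IsDedekindDomain.HeightOneSpectrum.valuation_of_algebraMap,
      IsDedekindDomain.HeightOneSpectrum.intValuation_eq_one_iff]
    exact fun hu => (IsDiscreteValuationRing.maximalIdeal 𝒪[F]).isPrime.ne_top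
      (Ideal.eq_top_of_isUnit_mem _ hu u.isUnit)
  change -WithZero.log ((IsDiscreteValuationRing.maximalIdeal 𝒪[F]).valuation F
      (algebraMap 𝒪[F] F (u : 𝒪[F]))) = 0
  rw [h]; simp

lemma ord_uniformizer (ϖ : Uniformizer F) : ord (ϖ.unit : F) = 1 := by
  change -WithZero.log ((IsDiscreteValuationRing.maximalIdeal 𝒪[F]).valuation F
      (algebraMap 𝒪[F] F ϖ.val)) = 1
  rw [IsDedekindDomain.HeightOneSpectrum.valuation_of_algebraMap,
    IsDedekindDomain.HeightOneSpectrum.intValuation_singleton _ ϖ.irreducible.ne_zero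
      ϖ.irreducible.maximalIdeal_eq]
  simp

/-- `g ↦ ord (det g) mod d` as a homomorphism on `GL_d(F)`. -/
def colGL (d : ℕ) : Matrix.GeneralLinearGroup (Fin d) F →* Multiplicative (ZMod d) where
  toFun g := Multiplicative.ofAdd ((ord (g.det : F) : ℤ) : ZMod d)
  map_one' := by simp [ord_one]
  map_mul' g h := by
    rw [map_mul, Units.val_mul, ord_mul g.det.ne_zero h.det.ne_zero]
    simp [ofAdd_add]

lemma ord_pow {x : F} (hx : x ≠ 0) (n : ℕ) : ord (x ^ n) = n * ord x := by
  induction n with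
  | zero => simp [ord_one]
  | succ n ih => rw [pow_succ, ord_mul (pow_ne_zero _ hx) hx, ih]; push_cast; ring

lemma center_le_ker_colGL (d : ℕ) :
    Subgroup.center (Matrix.GeneralLinearGroup (Fin d) F) ≤ (colGL (F := F) d).ker := by
  rw [Matrix.GeneralLinearGroup.center_eq_range_scalar]
  rintro _ ⟨a, rfl⟩
  rw [MonoidHom.mem_ker]
  have h : ((Matrix.GeneralLinearGroup.scalar (Fin d) a).det : F) = (a : F) ^ d := by
    simp [Matrix.GeneralLinearGroup.scalar]
  change Multiplicative.ofAdd ((ord ((Matrix.GeneralLinearGroup.scalar (Fin d) a).det : F) : ℤ) :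
    ZMod d) = 1
  rw [h, ord_pow a.ne_zero]
  simp

/-- `ord (det g) mod d` on `PGL_d(F)`. -/
def colPGL (d : ℕ) : PGL F d →* Multiplicative (ZMod d) :=
  QuotientGroup.lift _ (colGL d) (center_le_ker_colGL d)

lemma colPGL_maxCompact {d : ℕ} {k : PGL F d} (hk : k ∈ maxCompact F d) : colPGL d k = 1 := by
  obtain ⟨u, rfl⟩ := hk
  change Multiplicative.ofAdd ((ord ((Matrix.GeneralLinearGroup.map (algebraMap 𝒪[F] F) u).det : F)
    : ℤ) : ZMod d) = 1
  have h : ((Matrix.GeneralLinearGroup.map (algebraMap 𝒪[F] F) u).det : F)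
      = ((u.det : 𝒪[F]) : F) := by
    rw [Matrix.GeneralLinearGroup.map_det]
    rfl
  rw [h, ord_integral_unit]
  simp

/-- The color of a vertex: `col (gξ) = ord (det g) ∈ ℤ/d`. -/
def col {d : ℕ} (v : Vertex F d) : ZMod d :=
  Quotient.liftOn' v (fun g => Multiplicative.toAdd (colPGL d g)) (by
    intro a b hab
    rw [QuotientGroup.leftRel_apply] at hab
    have h := colPGL_maxCompact hab
    rw [map_mul, map_inv, inv_mul_eq_one] at h
    simp only [h])

lemma col_vtx {d : ℕ} (g : Matrix.GeneralLinearGroup (Fin d) F) :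
    col (vtx g) = ((ord (g.det : F) : ℤ) : ZMod d) := by
  change Multiplicative.toAdd (colPGL d (toPGL g * 1)) = _
  rw [mul_one]
  rfl

lemma col_smul {d : ℕ} (g : PGL F d) (v : Vertex F d) :
    col (g • v) = Multiplicative.toAdd (colPGL d g) + col v := by
  induction v using Quotient.inductionOn' with
  | h a =>
    change Multiplicative.toAdd (colPGL d (g * a)) = _ + Multiplicative.toAdd (colPGL d a)
    rw [map_mul, toAdd_mul]

variable (ϖ : Uniformizer F)

/-- A set `s` of vertices is an `r`-dimensional cell of the building `ℬ` if its members can be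
enumerated, and representing matrices `g₀, …, g_r` of them (a representing matrix may be multiplied
by a scalar) can be chosen, such that
`ϖ g₀ 𝒪^d < g_r 𝒪^d < ⋯ < g₁ 𝒪^d < g₀ 𝒪^d`. -/
def IsCellOfDim {d : ℕ} (r : ℕ) (s : Set (Vertex F d)) : Prop :=
  ∃ g : Fin (r + 1) → Matrix.GeneralLinearGroup (Fin d) F,
    s = Set.range (fun i => vtx (g i)) ∧ StrictAnti (fun i => lattice (g i)) ∧
      ϖ.val • lattice (g 0) < lattice (g (Fin.last r))

/-- A set of vertices is a cell of the building `ℬ`. -/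
def IsCell {d : ℕ} (s : Set (Vertex F d)) : Prop := ∃ r, IsCellOfDim ϖ r s

lemma map_toLin_strictMono {d : ℕ} (h : Matrix.GeneralLinearGroup (Fin d) F) :
    StrictMono (fun L : Submodule 𝒪[F] (Fin d → F) => L.map
      ((Matrix.toLin' (h : Matrix (Fin d) (Fin d) F)).restrictScalars 𝒪[F])) :=
  Submodule.map_strictMono_of_injective (toLin_injective h)

lemma vtx_mul {d : ℕ} (h g : Matrix.GeneralLinearGroup (Fin d) F) :
    vtx (h * g) = toPGL h • vtx g := by
  unfold vtx toPGL
  rw [smul_smul]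
  rfl

lemma IsCellOfDim.smul {d r : ℕ} {s : Set (Vertex F d)} (hs : IsCellOfDim ϖ r s) (h : PGL F d) :
    IsCellOfDim ϖ r ((fun v => h • v) '' s) := by
  obtain ⟨g, rfl, hg, hlast⟩ := hs
  obtain ⟨h, rfl⟩ := QuotientGroup.mk_surjective h
  refine ⟨fun i => h * g i, ?_, ?_, ?_⟩
  · rw [← Set.range_comp]
    congr 1
    funext i
    exact (vtx_mul h (g i)).symm
  · intro i j hij
    simp only [lattice_mul]
    exact map_toLin_strictMono h (hg hij)
  · simp only [lattice_mul]
    rw [← Submodule.map_pointwise_smul]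
    exact map_toLin_strictMono h hlast

/-- An ordered `j`-cell `[v₀, …, v_j]` of type one: the colors satisfy
`col v_{i+1} = col v_i + 1` for `0 ≤ i < j`. -/
def IsTypeOne {d j : ℕ} (σ : Fin (j + 1) → Vertex F d) : Prop :=
  IsCellOfDim ϖ j (Set.range σ) ∧ ∀ i : Fin j, col (σ i.succ) = col (σ i.castSucc) + 1

variable (d : ℕ)

/-- The ordered `j`-cells of type one, with the (coordinatewise) action of `PGL_d(F)`. -/
def typeOneCells (j : ℕ) : SubMulAction (PGL F d) (Fin (j + 1) → Vertex F d) where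
  carrier := {σ | IsTypeOne ϖ σ}
  smul_mem' g σ hσ := by
    refine ⟨?_, fun i => ?_⟩
    · have := hσ.1.smul ϖ g
      rw [← Set.range_comp] at this
      exact this
    · simp only [Pi.smul_apply, col_smul, hσ.2 i, add_assoc]

/-- `ℬ₁ʲ`, the type of ordered `j`-cells of type one. -/
abbrev B1 (j : ℕ) : Type _ := typeOneCells ϖ d j

/-- The matrix `diag(1, …, 1, ϖ, …, ϖ)` with `i` entries `1` and `d - i` entries `ϖ`. -/
def xiMat (i : ℕ) : Matrix.GeneralLinearGroup (Fin d) F :=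
  diag fun k => if k.val < i then 1 else ϖ.unit

/-- The vertex `ξ_i = diag(1, …, 1, ϖ, …, ϖ) ξ` (`i` entries `1`, `d - i` entries `ϖ`). -/
def xiVertex (i : ℕ) : Vertex F d := vtx (xiMat ϖ d i)

lemma ord_det_xiMat {i : ℕ} (hi : i ≤ d) : ord ((xiMat ϖ d i).det : F) = d - i := by
  have h : ((xiMat ϖ d i).det : F) = (ϖ.unit : F) ^ (d - i) := by
    change Matrix.det (Matrix.diagonal fun k : Fin d =>
      (((if k.val < i then 1 else ϖ.unit : Fˣ)) : F)) = _
    rw [Matrix.det_diagonal]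
    rw [Finset.prod_congr rfl (g := fun k : Fin d => if k.val < i then (1 : F) else (ϖ.unit : F))
      (by intro k _; split_ifs <;> simp)]
    rw [Finset.prod_ite, Finset.prod_const_one, one_mul, Finset.prod_const]
    congr 1
    have := Fin.card_filter_val_lt (n := d) (m := i)
    have h2 := Finset.card_filter_add_card_filter_not (s := (Finset.univ : Finset (Fin d)))
      (fun k : Fin d => k.val < i)
    simp only [Finset.card_univ, Fintype.card_fin] at h2
    omega
  rw [h, ord_pow ϖ.unit.ne_zero, ord_uniformizer, mul_one]
  push_cast [hi]
  ring

lemma uniformizer_inv_notMem : ((ϖ.unit⁻¹ : Fˣ) : F) ∉ 𝒪[F] := by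
  intro h
  refine ϖ.irreducible.not_isUnit (IsUnit.of_mul_eq_one ⟨_, h⟩ ?_)
  ext
  simp [Uniformizer.unit, ϖ.irreducible.ne_zero]

lemma uniformizer_mem : ((ϖ.unit : Fˣ) : F) ∈ 𝒪[F] := ϖ.val.2

lemma lattice_xiMat_lt {a b : ℕ} (hab : a < b) (hb : b ≤ d) :
    lattice (xiMat ϖ d a) < lattice (xiMat ϖ d b) := by
  refine lt_of_le_of_ne ?_ ?_
  · intro v hv
    simp only [xiMat, mem_lattice_diag] at hv ⊢
    intro i
    have := hv i
    by_cases h1 : i.val < a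
    · have h2 : i.val < b := by omega
      simpa [h1, h2] using this
    · by_cases h2 : i.val < b
      · simp only [h1, h2, if_true, if_false] at this ⊢
        have := mul_mem (uniformizer_mem ϖ) this
        simpa using this
      · simpa [h1, h2] using this
  · intro h
    have : (Pi.single ⟨a, by omega⟩ 1 : Fin d → F) ∈ lattice (xiMat ϖ d b) := by
      simp only [xiMat, mem_lattice_diag]
      intro i
      by_cases hi : i = ⟨a, by omega⟩
      · subst hi
        simp [hab, one_mem]
      · simp [hi, zero_mem]
    rw [← h] at this
    simp only [xiMat, mem_lattice_diag] at this
    have h3 := this ⟨a, by omega⟩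
    simp only [lt_irrefl, if_false, Pi.single_eq_same, mul_one] at h3
    exact uniformizer_inv_notMem ϖ h3

lemma lattice_xiMat_zero : lattice (xiMat ϖ d 0) = ϖ.val • lattice (xiMat ϖ d d) := by
  ext v
  simp only [Submodule.mem_smul_pointwise_iff_exists, xiMat, mem_lattice_diag]
  constructor
  · intro h
    refine ⟨fun i => ((ϖ.unit⁻¹ : Fˣ) : F) * v i, fun i => by simpa using h i, ?_⟩
    ext i
    change (ϖ.unit : F) * (((ϖ.unit⁻¹ : Fˣ) : F) * v i) = v i
    simp
  · rintro ⟨u, hu, rfl⟩ i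
    have h1 : u i ∈ 𝒪[F] := by simpa using hu i
    have h2 : ((ϖ.unit⁻¹ : Fˣ) : F) * ((ϖ.unit : F) * u i) ∈ 𝒪[F] := by simpa using h1
    exact h2

/-- The cell `σʲ = [ξ_j, ξ_{j-1}, …, ξ₀]`, for `0 ≤ j ≤ d - 1`. -/
def baseCell (j : ℕ) (hj : j < d) : B1 ϖ d j :=
  ⟨fun i => xiVertex ϖ d (j - i.val), by
    refine ⟨⟨fun i => xiMat ϖ d (j - i.val), rfl, ?_, ?_⟩, ?_⟩
    · intro a b hab
      exact lattice_xiMat_lt ϖ d (by have := a.2; have := b.2; omega) (by omega)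
    · have h0 : xiMat ϖ d (j - (Fin.last j).val) = xiMat ϖ d 0 := by simp
      change _ < lattice (xiMat ϖ d (j - (Fin.last j).val))
      rw [h0, lattice_xiMat_zero]
      have h1 := lattice_xiMat_lt ϖ d (a := j) (b := d) hj le_rfl
      have h2 : Function.Injective
          (fun v : Fin d → F => ϖ.val • v) := fun v w hvw => by
        ext i
        have h3 : (ϖ.unit : F) * v i = (ϖ.unit : F) * w i := congrFun hvw i
        exact mul_left_cancel₀ ϖ.unit.ne_zero h3
      exact Submodule.map_strictMono_of_injective
        (f := DistribSMul.toLinearMap 𝒪[F] (Fin d → F) ϖ.val) h2 h1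
    · intro i
      unfold xiVertex
      rw [col_vtx, col_vtx, ord_det_xiMat ϖ d (by omega), ord_det_xiMat ϖ d (by omega)]
      have : j - i.castSucc.val = (j - i.succ.val) + 1 := by
        have := i.2; simp only [Fin.val_castSucc, Fin.val_succ]; omega
      rw [this]
      push_cast
      ring⟩

/-! ### The geometric operators -/

/-- The identification of `ℬ⁰` with `ℬ₁⁰`. -/
def vertexCell : Branching (Vertex F d) (B1 ϖ d 0) := fun v => {σ | σ.1 0 = v}

/-- The geodesic `j`-flow `T_j` on `ℬ₁ʲ`: it takes `[v₀, …, v_j]` to all cells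
`[v₁, …, v_j, w] ∈ ℬ₁ʲ` such that `{v₀, …, v_j, w}` is not a cell of `ℬ`. -/
def flow (j : ℕ) : Branching (B1 ϖ d j) (B1 ϖ d j) :=
  fun σ => {τ | (∀ i : Fin j, τ.1 i.castSucc = σ.1 i.succ) ∧
    ¬ IsCell ϖ (insert (τ.1 (Fin.last j)) (Set.range σ.1))}

/-- `T_{j,j+1} : ℬ₁ʲ → ℬ₁ʲ⁺¹` takes `σ` to all cells `vσ ∈ ℬ₁ʲ⁺¹` with `v ∈ ℬ⁰`. -/
def raise (j : ℕ) : Branching (B1 ϖ d j) (B1 ϖ d (j + 1)) :=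
  fun σ => {τ | ∃ v : Vertex F d, τ.1 = Fin.cons v σ.1}

/-- `T_{j,0} : ℬ₁ʲ → ℬ⁰` returns the last vertex of a cell (used for `j = d - 1`). -/
def lastVertex (j : ℕ) : Branching (B1 ϖ d j) (Vertex F d) := fun σ => {σ.1 (Fin.last j)}

/-- The composition `∏_{i=j}^{1} T_i^{i x_i} T_{i-1,i}`, for `0 ≤ j ≤ d - 1`; the rightmost factor,
with `i = 1`, acts first. The coordinates `x₁, …, x_{d-1}` of `x` are `x 0, …, x (d - 2)`. -/
def ascent (x : Fin (d - 1) → ℕ) : (j : ℕ) → j < d → Branching (B1 ϖ d 0) (B1 ϖ d j)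
  | 0, _ => fun σ => {σ}
  | j + 1, h =>
    ((flow ϖ d (j + 1)).pow ((j + 1) * x ⟨j, by omega⟩)).comp
      ((raise ϖ d j).comp (ascent x j (by omega)))

/-- The operator `T_x = T_{d-1,0} ∏_{j=d-1}^{1} T_j^{j x_j} T_{j-1,j} : ℬ⁰ → ℬ⁰`. -/
def fiberOp (hd : 2 ≤ d) (x : Fin (d - 1) → ℕ) : Branching (Vertex F d) (Vertex F d) :=
  (lastVertex ϖ d (d - 1)).comp ((ascent ϖ d x (d - 1) (by omega)).comp (vertexCell ϖ d))

/-! ### The Cartan projection -/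

/-- The vertex of the sector with coordinates `x = (x₁, …, x_{d-1})`, i.e.
`diag(ϖ^{α₁}, …, ϖ^{α_d}) ξ` with `α_i = x_i + ⋯ + x_{d-1}`, so that
`α_i - α_{i+1} = x_i` and `α_d = 0`. -/
def sectorVertex (x : Fin (d - 1) → ℕ) : Vertex F d :=
  vtx (diag fun i => ϖ.unit ^ (∑ k : Fin (d - 1) with i.val ≤ k.val, x k))

/-- The map `ℕ^{d-1} → K\ℬ⁰` induced by the identification of `ℕ^{d-1}` with the sector. -/
def sectorOrbit (x : Fin (d - 1) → ℕ) :
    MulAction.orbitRel.Quotient (maxCompact F d) (Vertex F d) :=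
  Quotient.mk'' (sectorVertex ϖ d x)

/-- The Cartan projection `Φ : ℬ⁰ → K\ℬ⁰ ≅ ℕ^{d-1}`, the second map being the inverse of
`sectorOrbit` (which is bijective by the Cartan decomposition). -/
def cartanProj (v : Vertex F d) : Fin (d - 1) → ℕ :=
  Function.invFun (sectorOrbit ϖ d) (Quotient.mk'' v)

/-! ### The elements `w_j` -/

/-- The matrix `w_j`: the first `j - 1` rows are `(0 | I_{j-1} | 0)`, the `j`-th row is
`(ϖ | 0 | 0)`, and the last `d - j` rows are `(0 | 0 | I_{d-j})`; the column blocks have widths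
`1`, `j - 1`, `d - j`. -/
def wMat (j : ℕ) : Matrix (Fin d) (Fin d) F :=
  Matrix.of fun r c =>
    if r.val + 1 < j then (if c.val = r.val + 1 then 1 else 0)
    else if r.val + 1 = j then (if c.val = 0 then (ϖ.unit : F) else 0)
    else (if c = r then 1 else 0)

lemma det_wMat_ne_zero (j : ℕ) (hj : j < d) : (wMat ϖ d j).det ≠ 0 := by
  intro h
  obtain ⟨v, hv, hv0⟩ := Matrix.exists_mulVec_eq_zero_iff.mpr h
  apply hv
  have key : ∀ r c : Fin d, (∀ c', c' ≠ c → wMat ϖ d j r c' = 0) → wMat ϖ d j r c ≠ 0 →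
      v c = 0 := by
    intro r c h0 h1
    have h2 := congrFun hv0 r
    rw [Matrix.mulVec, dotProduct, Finset.sum_eq_single c (fun c' _ hc' => by rw [h0 c' hc', zero_mul])
      (by simp)] at h2
    exact (mul_eq_zero.mp h2).resolve_left h1
  ext c
  by_cases h1 : c.val = 0 ∧ 0 < j
  · refine key ⟨j - 1, by omega⟩ c (fun c' hc' => ?_) ?_
    · have : c'.val ≠ 0 := fun h => hc' (Fin.ext (by omega))
      simp [wMat, show j - 1 + 1 = j by omega, this]
    · simp [wMat, show j - 1 + 1 = j by omega, h1.1]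
  · by_cases h2 : c.val < j
    · refine key ⟨c.val - 1, by omega⟩ c (fun c' hc' => ?_) ?_
      · have : c'.val ≠ c.val := fun h => hc' (Fin.ext h)
        simp [wMat, show c.val - 1 + 1 = c.val by omega, h2, this]
      · simp [wMat, show c.val - 1 + 1 = c.val by omega, h2]
    · refine key c c (fun c' hc' => ?_) ?_
      · simp [wMat, show ¬ (c.val + 1 < j) by omega, show ¬ (c.val + 1 = j) by omega, hc']
      · simp [wMat, show ¬ (c.val + 1 < j) by omega, show ¬ (c.val + 1 = j) by omega]

/-- The element `w_j` of `PGL_d(F)`. -/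
def w (j : ℕ) (hj : j < d) : PGL F d :=
  toPGL (Matrix.GeneralLinearGroup.mkOfDetNeZero (wMat ϖ d j) (det_wMat_ne_zero ϖ d j hj))

end LocalField

end

end BruhatTits

namespace BruhatTits

open Matrix (GeneralLinearGroup)

section LocalField

set_option linter.unusedSectionVars false

variable {F : Type*} [Field F] [ValuativeRel F] [TopologicalSpace F] [IsNonarchimedeanLocalField F]

/-! ### The normalized valuation -/

/-! The whole statement is reduced to one fact: at suitable cells of the standard apartment, the
stabilizer of the cell in `K` acts transitively on the branches of the operator, and one of these
branches is again standard.

A vertex of the standard apartment is given by integer exponents `e` through `diag(ϖ^e)`, up to a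
common shift; larger exponents mean smaller lattices. A standard geodesic of period `j` raises by
one the exponents at positions `j - 1, …, 0` (counted from zero) in turn, and its cell at time `t`
consists of the vertices at times `t - j, …, t`. The `j`-flow takes this cell to the one at time `t
+ 1`. If no exponent at a position `≥ j` exceeds those at positions `< j`, every other branch is a
translate by an integral unipotent matrix fixing the cell (`exists_of_mem_flow`). If the exponents
at positions `≥ j` are all equal, the cells obtained by adding a new first vertex are likewise
conjugate under integral matrices fixing the cell (`exists_of_mem_raise`).

Both remaining claims follow from equivariance. An equivariant operator with transitive branching
takes a `K`-orbit to a `K`-orbit (`BranchesTransitively.biUnion_kOrbit`). Along `T_x` the exponents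
at positions `≥ j` stay `0` until dimension `j` has been passed, while `(j + 1) x_{j+1}` steps of
the `(j + 1)`-flow raise the first `j + 1` exponents by `x_{j+1}`; hence `T_x(ξ)` is the `K`-orbit
of the sector vertex, which is the fiber of `Φ`. For constant exponents the standard cells are the
`σʲ`, and `w_j` moves `σʲ` one step along its geodesic; as `G` is transitive on `ℬ₁ʲ`, transitive
branching at `σʲ` identifies the operator with its double coset (`Branching.Equivariant.eq_hecke`).

The Cartan decomposition itself comes from elementary divisors (`exists_smith`) for existence, and
from the Leibniz expansion of a determinant (`le_of_lattice_mul_dz_le`) for uniqueness. -/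

lemma ord_inv {x : F} (hx : x ≠ 0) : ord x⁻¹ = -ord x := by
  have h := ord_mul hx (inv_ne_zero hx)
  rw [mul_inv_cancel₀ hx, ord_one] at h
  omega

lemma ord_nonneg {x : F} (hx : x ≠ 0) (h : x ∈ 𝒪[F]) : 0 ≤ ord x := by
  unfold ord
  have h1 : (IsDiscreteValuationRing.maximalIdeal 𝒪[F]).valuation F x ≤ 1 :=
    IsDedekindDomain.HeightOneSpectrum.valuation_le_one _ (⟨x, h⟩ : 𝒪[F])
  have h2 : (IsDiscreteValuationRing.maximalIdeal 𝒪[F]).valuation F x ≠ 0 := by simpa using hx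
  have := (WithZero.log_le_log h2 one_ne_zero).mpr h1
  simpa using this

lemma ord_unit_zpow (ϖ : Uniformizer F) (n : ℤ) : ord ((ϖ.unit ^ n : Fˣ) : F) = n := by
  have key : ∀ m : ℕ, ord ((ϖ.unit ^ m : Fˣ) : F) = m := fun m => by
    rw [Units.val_pow_eq_pow_val, ord_pow ϖ.unit.ne_zero, ord_uniformizer, mul_one]
  obtain ⟨m, rfl | rfl⟩ := n.eq_nat_or_neg
  · simpa using key m
  · rw [zpow_neg, Units.val_inv_eq_inv_val, ord_inv (Units.ne_zero _), zpow_natCast, key]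

lemma unit_zpow_mem (ϖ : Uniformizer F) {n : ℤ} (hn : 0 ≤ n) : ((ϖ.unit ^ n : Fˣ) : F) ∈ 𝒪[F] := by
  lift n to ℕ using hn
  rw [zpow_natCast, Units.val_pow_eq_pow_val]
  exact pow_mem (uniformizer_mem ϖ) n

/-- Every nonzero element is a unit of `𝒪` times a power of the uniformizer. -/
lemma exists_unit_mul_zpow (ϖ : Uniformizer F) {x : F} (hx : x ≠ 0) :
    ∃ u : 𝒪[F]ˣ, x = ((u : 𝒪[F]) : F) * ((ϖ.unit ^ ord x : Fˣ) : F) := by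
  have key : ∀ y : 𝒪[F], y ≠ 0 → ∃ (u : 𝒪[F]ˣ) (n : ℤ),
      (y : F) = ((u : 𝒪[F]) : F) * ((ϖ.unit ^ n : Fˣ) : F) := fun y hy => by
    obtain ⟨n, u, hu⟩ := IsDiscreteValuationRing.eq_unit_mul_pow_irreducible hy ϖ.irreducible
    refine ⟨u, n, ?_⟩
    rw [hu, zpow_natCast, Units.val_pow_eq_pow_val]
    rfl
  obtain ⟨a, b, hb, rfl⟩ := IsFractionRing.div_surjective (A := 𝒪[F]) x
  have hb0 : b ≠ 0 := nonZeroDivisors.ne_zero hb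
  have ha0 : a ≠ 0 := by rintro rfl; simp at hx
  obtain ⟨u, m, hu⟩ := key a ha0
  obtain ⟨v, n, hv⟩ := key b hb0
  have hv0 : ((v : 𝒪[F]) : F) ≠ 0 := by simp
  have hvi : (((v⁻¹ : 𝒪[F]ˣ) : 𝒪[F]) : F) = ((v : 𝒪[F]) : F)⁻¹ := by
    refine eq_inv_of_mul_eq_one_left ?_
    exact congrArg (fun z : 𝒪[F] => (z : F)) v.inv_mul
  have e : (algebraMap 𝒪[F] F a / algebraMap 𝒪[F] F b)
      = (((u * v⁻¹ : 𝒪[F]ˣ) : 𝒪[F]) : F) * ((ϖ.unit ^ (m - n) : Fˣ) : F) := by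
    change (a : F) / (b : F) = _
    rw [hu, hv, zpow_sub]
    have : (((u * v⁻¹ : 𝒪[F]ˣ) : 𝒪[F]) : F) = ((u : 𝒪[F]) : F) * ((v : 𝒪[F]) : F)⁻¹ := by
      rw [← hvi]; simp
    rw [this, Units.val_mul, Units.val_inv_eq_inv_val, mul_div_mul_comm, div_eq_mul_inv,
      div_eq_mul_inv]
  have ho : ord (algebraMap 𝒪[F] F a / algebraMap 𝒪[F] F b) = m - n := by
    rw [e, ord_mul (by simp) (Units.ne_zero _), ord_integral_unit, ord_unit_zpow, zero_add]
  exact ⟨u * v⁻¹, by rw [ho]; exact e⟩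

lemma mem_integer_iff (ϖ : Uniformizer F) {x : F} (hx : x ≠ 0) : x ∈ 𝒪[F] ↔ 0 ≤ ord x := by
  refine ⟨ord_nonneg hx, fun h => ?_⟩
  obtain ⟨u, hu⟩ := exists_unit_mul_zpow ϖ hx
  rw [hu]
  exact mul_mem (u : 𝒪[F]).2 (unit_zpow_mem ϖ h)

lemma inv_mem_of_ord_eq_zero (ϖ : Uniformizer F) {x : F} (hx : x ≠ 0) (h : ord x = 0) :
    x⁻¹ ∈ 𝒪[F] :=
  (mem_integer_iff ϖ (inv_ne_zero hx)).2 (by rw [ord_inv hx, h, neg_zero])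

lemma unit_zpow_mem_iff (ϖ : Uniformizer F) {n : ℤ} : ((ϖ.unit ^ n : Fˣ) : F) ∈ 𝒪[F] ↔ 0 ≤ n := by
  rw [mem_integer_iff ϖ (Units.ne_zero _), ord_unit_zpow]

/-- An element of `F` is divisible by the uniformizer or has integral inverse. -/
lemma inv_mem_or_mem (ϖ : Uniformizer F) {x : F} (hx : x ≠ 0) :
    x⁻¹ ∈ 𝒪[F] ∨ ((ϖ.unit ^ (-1 : ℤ) : Fˣ) : F) * x ∈ 𝒪[F] := by
  rw [mem_integer_iff ϖ (inv_ne_zero hx), mem_integer_iff ϖ (by simp [hx]),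
    ord_mul (Units.ne_zero _) hx, ord_unit_zpow, ord_inv hx]
  omega

/-! ### Lattices -/

variable {d : ℕ}

/-- The order of the determinant. -/
noncomputable def gord (g : GeneralLinearGroup (Fin d) F) : ℤ := ord (g.det : F)

lemma gord_mul (g h : GeneralLinearGroup (Fin d) F) : gord (g * h) = gord g + gord h := by
  unfold gord
  rw [map_mul, Units.val_mul, ord_mul (Units.ne_zero _) (Units.ne_zero _)]

lemma gord_one : gord (1 : GeneralLinearGroup (Fin d) F) = 0 := by simp [gord, ord_one]

lemma gord_inv (g : GeneralLinearGroup (Fin d) F) : gord g⁻¹ = -gord g := by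
  have := gord_mul g g⁻¹
  rw [mul_inv_cancel, gord_one] at this
  omega

/-- The matrix `diag(ϖ^{e₁}, …, ϖ^{e_d})`. -/
noncomputable def dz (ϖ : Uniformizer F) (e : Fin d → ℤ) : GeneralLinearGroup (Fin d) F :=
  diag fun i => ϖ.unit ^ e i

/-- The scalar matrix `ϖ^n`. -/
noncomputable def sc (ϖ : Uniformizer F) (d : ℕ) (n : ℤ) : GeneralLinearGroup (Fin d) F :=
  dz ϖ fun _ => n

lemma dz_val (ϖ : Uniformizer F) (e : Fin d → ℤ) :
    (dz ϖ e : Matrix (Fin d) (Fin d) F) = Matrix.diagonal fun i => ((ϖ.unit ^ e i : Fˣ) : F) := rfl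

lemma dz_inv_val (ϖ : Uniformizer F) (e : Fin d → ℤ) :
    ((dz ϖ e)⁻¹ : GeneralLinearGroup (Fin d) F).val =
      Matrix.diagonal fun i => ((ϖ.unit ^ (-e i) : Fˣ) : F) := by
  simp only [zpow_neg]
  rfl

lemma dz_mul (ϖ : Uniformizer F) (e f : Fin d → ℤ) : dz ϖ e * dz ϖ f = dz ϖ (e + f) := by
  apply Units.ext
  rw [Units.val_mul, dz_val, dz_val, dz_val, Matrix.diagonal_mul_diagonal]
  congr 1
  funext i
  simp [zpow_add]

lemma gord_dz (ϖ : Uniformizer F) (e : Fin d → ℤ) : gord (dz ϖ e) = ∑ i, e i := by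
  have h : ((dz ϖ e).det : Fˣ) = ϖ.unit ^ (∑ i, e i) := by
    apply Units.ext
    change Matrix.det (Matrix.diagonal fun i => ((ϖ.unit ^ e i : Fˣ) : F)) = _
    rw [Matrix.det_diagonal, ← Units.coe_prod]
    congr 1
    induction (Finset.univ : Finset (Fin d)) using Finset.induction_on with
    | empty => simp
    | insert a s ha ih => rw [Finset.prod_insert ha, Finset.sum_insert ha, zpow_add, ih]
  unfold gord
  rw [h, ord_unit_zpow]

lemma gord_sc (ϖ : Uniformizer F) (n : ℤ) : gord (sc ϖ d n) = d * n := by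
  simp [sc, gord_dz]

lemma sc_mul_comm (ϖ : Uniformizer F) (n : ℤ) (g : GeneralLinearGroup (Fin d) F) :
    sc ϖ d n * g = g * sc ϖ d n :=
  GeneralLinearGroup.scalar_commute (ϖ.unit ^ n) g

lemma sc_zero (ϖ : Uniformizer F) : sc ϖ d 0 = 1 := by
  apply Units.ext
  simp [sc, dz_val]

lemma sc_mul_sc (ϖ : Uniformizer F) (m n : ℤ) : sc ϖ d m * sc ϖ d n = sc ϖ d (m + n) := dz_mul ..

lemma sc_mul_dz (ϖ : Uniformizer F) (n : ℤ) (e : Fin d → ℤ) :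
    sc ϖ d n * dz ϖ e = dz ϖ (fun i => n + e i) := dz_mul ..

lemma toPGL_sc (ϖ : Uniformizer F) (n : ℤ) : toPGL (sc ϖ d n) = 1 :=
  (QuotientGroup.eq_one_iff _).2 (by
    rw [GeneralLinearGroup.center_eq_range_scalar]
    exact ⟨ϖ.unit ^ n, rfl⟩)

lemma vtx_sc_mul (ϖ : Uniformizer F) (n : ℤ) (g : GeneralLinearGroup (Fin d) F) :
    vtx (sc ϖ d n * g) = vtx g := by
  rw [vtx_mul, toPGL_sc, one_smul]

lemma mem_lattice_iff_inv {g : GeneralLinearGroup (Fin d) F} {v : Fin d → F} :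
    v ∈ lattice g ↔ ∀ i, (g⁻¹).val.mulVec v i ∈ 𝒪[F] := by
  rw [mem_lattice]
  constructor
  · rintro ⟨u, hu, rfl⟩ i
    rw [Matrix.mulVec_mulVec, ← Units.val_mul, inv_mul_cancel, Units.val_one, Matrix.one_mulVec]
    exact hu i
  · intro h
    refine ⟨(g⁻¹).val.mulVec v, h, ?_⟩
    rw [Matrix.mulVec_mulVec, ← Units.val_mul, mul_inv_cancel, Units.val_one, Matrix.one_mulVec]

lemma mem_lattice_dz (ϖ : Uniformizer F) (e : Fin d → ℤ) (v : Fin d → F) :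
    v ∈ lattice (dz ϖ e) ↔ ∀ i, ((ϖ.unit ^ (-e i) : Fˣ) : F) * v i ∈ 𝒪[F] := by
  simp only [dz, mem_lattice_diag, zpow_neg]

lemma mulVec_mem {A : Matrix (Fin d) (Fin d) F} (hA : ∀ i j, A i j ∈ 𝒪[F]) {v : Fin d → F}
    (hv : ∀ i, v i ∈ 𝒪[F]) (i : Fin d) : A.mulVec v i ∈ 𝒪[F] := by
  rw [Matrix.mulVec, dotProduct]
  exact sum_mem fun j _ => mul_mem (hA i j) (hv j)

lemma lattice_le_iff {g h : GeneralLinearGroup (Fin d) F} :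
    lattice g ≤ lattice h ↔ ∀ i j, (h⁻¹ * g).val i j ∈ 𝒪[F] := by
  constructor
  · intro H i j
    have h1 : g.val.mulVec (Pi.single j 1) ∈ lattice g := mem_lattice.2 ⟨_, fun k => by
      rcases eq_or_ne k j with rfl | hk
      · simp [one_mem]
      · simp [hk, zero_mem], rfl⟩
    have h2 := mem_lattice_iff_inv.1 (H h1) i
    rwa [Matrix.mulVec_mulVec, ← Units.val_mul, Matrix.mulVec_single_one] at h2
  · intro H v hv
    obtain ⟨u, hu, rfl⟩ := mem_lattice.1 hv
    refine mem_lattice_iff_inv.2 fun i => ?_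
    rw [Matrix.mulVec_mulVec, ← Units.val_mul]
    exact mulVec_mem H hu i

lemma lattice_mul_le_mul {k g h : GeneralLinearGroup (Fin d) F} :
    lattice (k * g) ≤ lattice (k * h) ↔ lattice g ≤ lattice h := by
  rw [lattice_le_iff, lattice_le_iff, mul_inv_rev, mul_assoc, inv_mul_cancel_left]

lemma lattice_mul_eq_mul {k g h : GeneralLinearGroup (Fin d) F} :
    lattice (k * g) = lattice (k * h) ↔ lattice g = lattice h := by
  simp only [le_antisymm_iff, lattice_mul_le_mul]

/-- Columnwise criterion for `g 𝒪^d ⊆ L`. -/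
lemma lattice_le_of_col {g : GeneralLinearGroup (Fin d) F} {L : Submodule 𝒪[F] (Fin d → F)}
    (H : ∀ j, (fun i => g.val i j) ∈ L) : lattice g ≤ L := by
  intro v hv
  obtain ⟨u, hu, rfl⟩ := mem_lattice.1 hv
  have : g.val.mulVec u = ∑ j, (⟨u j, hu j⟩ : 𝒪[F]) • (fun i => g.val i j) := by
    ext i
    simp only [Matrix.mulVec, dotProduct, Finset.sum_apply, Pi.smul_apply]
    exact Finset.sum_congr rfl fun j _ => mul_comm _ _
  rw [this]
  exact sum_mem fun j _ => L.smul_mem _ (H j)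

lemma det_mem {A : Matrix (Fin d) (Fin d) F} (hA : ∀ i j, A i j ∈ 𝒪[F]) : A.det ∈ 𝒪[F] := by
  rw [Matrix.det_apply]
  refine sum_mem fun σ _ => ?_
  rw [Units.smul_def]
  exact zsmul_mem (prod_mem fun i _ => hA _ _) _

lemma gord_le_of_lattice_le {g h : GeneralLinearGroup (Fin d) F} (H : lattice g ≤ lattice h) :
    gord h ≤ gord g := by
  have h1 : 0 ≤ gord (h⁻¹ * g) := ord_nonneg (Units.ne_zero _) (det_mem (lattice_le_iff.1 H))
  rw [gord_mul, gord_inv] at h1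
  omega

/-- An integral matrix whose determinant is a unit of `𝒪` comes from `GL_d(𝒪)`. -/
lemma exists_map_eq (ϖ : Uniformizer F) {g : GeneralLinearGroup (Fin d) F}
    (hg : ∀ i j, g.val i j ∈ 𝒪[F]) (h0 : gord g = 0) :
    ∃ k : GeneralLinearGroup (Fin d) 𝒪[F], GeneralLinearGroup.map (algebraMap 𝒪[F] F) k = g := by
  let A : Matrix (Fin d) (Fin d) 𝒪[F] := Matrix.of fun i j => ⟨g.val i j, hg i j⟩
  have hA : (algebraMap 𝒪[F] F).mapMatrix A = g.val := rfl
  have hd : ((A.det : 𝒪[F]) : F) = (g.det : F) := by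
    have := (algebraMap 𝒪[F] F).map_det A
    rw [hA] at this
    exact this
  have hu : IsUnit A.det := by
    refine IsUnit.of_mul_eq_one ⟨(g.det : F)⁻¹, inv_mem_of_ord_eq_zero ϖ (Units.ne_zero _) h0⟩ ?_
    apply Subtype.ext
    change ((A.det : 𝒪[F]) : F) * (g.det : F)⁻¹ = 1
    rw [hd, mul_inv_cancel₀ (Units.ne_zero _)]
  exact ⟨GeneralLinearGroup.mk'' A hu, Units.ext hA⟩

lemma map_integral (k : GeneralLinearGroup (Fin d) 𝒪[F]) (i j : Fin d) :
    (GeneralLinearGroup.map (algebraMap 𝒪[F] F) k).val i j ∈ 𝒪[F] := (k.val i j).2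

lemma gord_map (k : GeneralLinearGroup (Fin d) 𝒪[F]) :
    gord (GeneralLinearGroup.map (algebraMap 𝒪[F] F) k) = 0 := by
  have h : ((GeneralLinearGroup.map (algebraMap 𝒪[F] F) k).det : F) = ((k.det : 𝒪[F]) : F) := by
    rw [GeneralLinearGroup.map_det]
    rfl
  unfold gord
  rw [h, ord_integral_unit]

/-- The transition matrix is integral and its determinant is a unit, so its inverse is integral too.
This replaces index counts: below, one inclusion and a comparison of determinants always suffice. -/
lemma lattice_eq_of_le (ϖ : Uniformizer F) {g h : GeneralLinearGroup (Fin d) F}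
    (H : lattice g ≤ lattice h) (H' : gord g = gord h) : lattice g = lattice h := by
  obtain ⟨k, hk⟩ := exists_map_eq ϖ (lattice_le_iff.1 H) (by rw [gord_mul, gord_inv]; omega)
  refine le_antisymm H (lattice_le_iff.2 fun i j => ?_)
  have : g⁻¹ * h = GeneralLinearGroup.map (algebraMap 𝒪[F] F) k⁻¹ := by
    rw [GeneralLinearGroup.map_inv, hk]; group
  rw [this]
  exact map_integral _ _ _

lemma gord_eq_of_lattice_eq {g h : GeneralLinearGroup (Fin d) F} (H : lattice g = lattice h) :
    gord g = gord h :=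
  le_antisymm (gord_le_of_lattice_le H.ge) (gord_le_of_lattice_le H.le)

lemma vtx_eq_iff {g h : GeneralLinearGroup (Fin d) F} :
    vtx g = vtx h ↔ (toPGL (g⁻¹ * h)) ∈ maxCompact F d := by
  unfold vtx xi
  change ((toPGL g * 1 : PGL F d) : Vertex F d) = ((toPGL h * 1 : PGL F d) : Vertex F d) ↔ _
  rw [mul_one, mul_one, QuotientGroup.eq]
  rfl

lemma vtx_eq_of_lattice_eq (ϖ : Uniformizer F) {g h : GeneralLinearGroup (Fin d) F}
    (H : lattice g = lattice h) : vtx g = vtx h := by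
  obtain ⟨k, hk⟩ := exists_map_eq ϖ (lattice_le_iff.1 H.ge) (by
    rw [gord_mul, gord_inv, gord_eq_of_lattice_eq H]; omega)
  rw [vtx_eq_iff, ← hk]
  exact ⟨k, rfl⟩

/-- Lattices of the same vertex are homothetic. -/
lemma exists_lattice_eq_of_vtx_eq (ϖ : Uniformizer F) {g h : GeneralLinearGroup (Fin d) F}
    (H : vtx g = vtx h) : ∃ n : ℤ, lattice h = lattice (sc ϖ d n * g) := by
  obtain ⟨k, hk⟩ := vtx_eq_iff.1 H
  have h1 := QuotientGroup.eq.1 hk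
  rw [GeneralLinearGroup.center_eq_range_scalar] at h1
  obtain ⟨a, ha⟩ := h1
  obtain ⟨u, hu⟩ := exists_unit_mul_zpow ϖ a.ne_zero
  have e : h = sc ϖ d (ord (a : F)) * g *
      GeneralLinearGroup.map (algebraMap 𝒪[F] F)
        (k * GeneralLinearGroup.scalar (Fin d) u) := by
    have h2 : h = g * GeneralLinearGroup.map (algebraMap 𝒪[F] F) k *
        GeneralLinearGroup.scalar (Fin d) a := by rw [ha]; group
    have h3 : a = Units.map (algebraMap 𝒪[F] F : 𝒪[F] →* F) u * ϖ.unit ^ (ord (a : F)) :=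
      Units.ext hu
    have h4 : GeneralLinearGroup.scalar (Fin d) a =
        GeneralLinearGroup.map (algebraMap 𝒪[F] F) (GeneralLinearGroup.scalar (Fin d) u) *
          sc ϖ d (ord (a : F)) := by
      rw [GeneralLinearGroup.map_scalar]
      conv_lhs => rw [h3]
      rw [map_mul]
      rfl
    rw [h2, h4, GeneralLinearGroup.map_mul, ← mul_assoc, ← sc_mul_comm]
    simp only [mul_assoc]
  refine ⟨ord (a : F), ?_⟩
  conv_lhs => rw [e]
  generalize sc ϖ d (ord (a : F)) * g = x
  refine lattice_eq_of_le ϖ (lattice_le_iff.2 fun i j => ?_) ?_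
  · rw [inv_mul_cancel_left]
    exact map_integral _ _ _
  · rw [gord_mul, gord_map, add_zero]

lemma lattice_eq_of_vtx_eq (ϖ : Uniformizer F) [NeZero d] {g h : GeneralLinearGroup (Fin d) F}
    (H : vtx g = vtx h) (H' : gord g = gord h) : lattice g = lattice h := by
  obtain ⟨n, hn⟩ := exists_lattice_eq_of_vtx_eq ϖ H
  have h1 := gord_eq_of_lattice_eq hn
  rw [gord_mul, gord_sc] at h1
  have h2 : (d : ℤ) * n = 0 := by omega
  have h3 : n = 0 := by
    rcases mul_eq_zero.1 h2 with h | h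
    · exact absurd (by exact_mod_cast h) (NeZero.ne d)
    · exact h
  rw [hn, h3, sc_zero, one_mul]

lemma smul_lattice (ϖ : Uniformizer F) (g : GeneralLinearGroup (Fin d) F) :
    ϖ.val • lattice g = lattice (sc ϖ d 1 * g) := by
  rw [lattice_mul]
  change (lattice g).map _ = (lattice g).map _
  congr 1
  ext v i
  simp [sc, dz_val, Matrix.mulVec_diagonal]
  rfl

lemma lattice_mul_dz_le_dz (ϖ : Uniformizer F) (u : GeneralLinearGroup (Fin d) F)
    (e f : Fin d → ℤ) : lattice (u * dz ϖ e) ≤ lattice (dz ϖ f) ↔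
      ∀ i j, u.val i j * ((ϖ.unit ^ (e j - f i) : Fˣ) : F) ∈ 𝒪[F] := by
  rw [lattice_le_iff]
  refine forall₂_congr fun i j => ?_
  rw [Units.val_mul, Units.val_mul, dz_inv_val, dz_val, Matrix.diagonal_mul, Matrix.mul_diagonal,
    sub_eq_neg_add, zpow_add, Units.val_mul]
  ring_nf

lemma lattice_dz_le_dz (ϖ : Uniformizer F) (e f : Fin d → ℤ) :
    lattice (dz ϖ e) ≤ lattice (dz ϖ f) ↔ ∀ i, f i ≤ e i := by
  have := lattice_mul_dz_le_dz ϖ 1 e f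
  rw [one_mul] at this
  rw [this]
  constructor
  · intro h i
    have := h i i
    rw [Units.val_one, Matrix.one_apply_eq, one_mul, unit_zpow_mem_iff] at this
    omega
  · intro h i j
    rcases eq_or_ne i j with rfl | hij
    · rw [Units.val_one, Matrix.one_apply_eq, one_mul, unit_zpow_mem_iff]
      have := h i
      omega
    · simp [hij, zero_mem]

lemma vtx_dz_add_const (ϖ : Uniformizer F) (n : ℤ) (e : Fin d → ℤ) :
    vtx (dz ϖ fun i => n + e i) = vtx (dz ϖ e) := by
  rw [← sc_mul_dz, vtx_sc_mul]

/-! ### Elementary divisors -/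

lemma exists_sc_mul_integral (ϖ : Uniformizer F) (g : GeneralLinearGroup (Fin d) F) :
    ∃ n : ℤ, ∀ i j, (sc ϖ d n * g).val i j ∈ 𝒪[F] := by
  obtain ⟨n, hn⟩ := Finite.exists_le fun p : Fin d × Fin d => -ord (g.val p.1 p.2)
  refine ⟨n, fun i j => ?_⟩
  rw [Units.val_mul, sc, dz_val, Matrix.diagonal_mul]
  by_cases h : g.val i j = 0
  · rw [h, mul_zero]; exact zero_mem _
  · rw [mem_integer_iff ϖ (mul_ne_zero (Units.ne_zero _) h), ord_mul (Units.ne_zero _) h,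
      ord_unit_zpow]
    have := hn (i, j)
    simp only at this
    omega

lemma exists_smith_of_integral (ϖ : Uniformizer F) {g : GeneralLinearGroup (Fin d) F}
    (hg : ∀ i j, g.val i j ∈ 𝒪[F]) :
    ∃ (k : GeneralLinearGroup (Fin d) 𝒪[F]) (e : Fin d → ℤ),
      lattice g = lattice (GeneralLinearGroup.map (algebraMap 𝒪[F] F) k * dz ϖ e) := by
  let A : Matrix (Fin d) (Fin d) 𝒪[F] := Matrix.of fun i j => ⟨g.val i j, hg i j⟩
  have hA : (algebraMap 𝒪[F] F).mapMatrix A = g.val := rfl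
  let ι : (Fin d → 𝒪[F]) →ₗ[𝒪[F]] (Fin d → F) :=
    { toFun := fun v i => (v i : F), map_add' := fun _ _ => rfl, map_smul' := fun _ _ => rfl }
  have hdet : A.det ≠ 0 := fun h => by
    have := (algebraMap 𝒪[F] F).map_det A
    rw [hA, h, map_zero] at this
    exact g.det_ne_zero this.symm
  have hinj : Function.Injective A.mulVecLin := by
    rw [injective_iff_map_eq_zero]
    exact fun v hv => Matrix.eq_zero_of_mulVec_eq_zero hdet hv
  obtain ⟨b, a, ab, hab⟩ := Submodule.exists_smith_normal_form_of_rank_eq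
    (Pi.basisFun 𝒪[F] (Fin d)) (N := LinearMap.range A.mulVecLin)
    (LinearMap.finrank_range_of_inj hinj)
  have ha : ∀ i, ((a i : 𝒪[F]) : F) ≠ 0 := fun i h => by
    have h0 : a i = 0 := Subtype.ext h
    have h1 := hab i
    rw [h0, zero_smul] at h1
    exact ab.ne_zero i (Subtype.ext h1)
  let B := (Pi.basisFun 𝒪[F] (Fin d)).toMatrix b
  have hB : IsUnit B.det := by
    have := (Pi.basisFun 𝒪[F] (Fin d)).invertibleToMatrix b
    exact (Matrix.isUnit_iff_isUnit_det _).1 (isUnit_of_invertible _)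
  have hcol : ∀ j, (fun i => (GeneralLinearGroup.map (algebraMap 𝒪[F] F)
      (GeneralLinearGroup.mk'' B hB) * dz ϖ fun i => ord (a i : F)).val i j) =
      ((ϖ.unit ^ ord (a j : F) : Fˣ) : F) • ι (b j) := fun j => by
    ext i
    rw [Units.val_mul, dz_val, Matrix.mul_diagonal, mul_comm]
    rfl
  -- Each elementary divisor is a unit times a power of `ϖ`; the unit does not affect the span, so
  -- pure powers of `ϖ` may be used.
  have hu : ∀ j, ∃ u : 𝒪[F]ˣ, ι (ab j : Fin d → 𝒪[F]) =
      (u : 𝒪[F]) • ((ϖ.unit ^ ord (a j : F) : Fˣ) : F) • ι (b j) := fun j => by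
    obtain ⟨u, hu⟩ := exists_unit_mul_zpow ϖ (ha j)
    refine ⟨u, ?_⟩
    rw [hab]
    ext i
    change ((a j : 𝒪[F]) : F) * (b j i : F) = ((u : 𝒪[F]) : F) * (_ * (b j i : F))
    rw [← mul_assoc, ← hu]
  refine ⟨GeneralLinearGroup.mk'' B hB, fun i => ord (a i : F), le_antisymm ?_ ?_⟩
  · refine lattice_le_of_col fun j => ?_
    have h1 : A.mulVec (Pi.single j 1) ∈ LinearMap.range A.mulVecLin := ⟨_, rfl⟩
    have h2 := ab.sum_repr ⟨_, h1⟩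
    have h3 : (fun i => g.val i j) =
        ∑ l, ab.repr ⟨_, h1⟩ l • ι (ab l : Fin d → 𝒪[F]) := by
      have h4 := congrArg (fun z : LinearMap.range A.mulVecLin => ι (z : Fin d → 𝒪[F])) h2
      simp only [Submodule.coe_sum, Submodule.coe_smul, map_sum, map_smul] at h4
      rw [h4, Matrix.mulVec_single_one]
      rfl
    rw [h3]
    refine sum_mem fun l _ => Submodule.smul_mem _ _ ?_
    obtain ⟨u, hu⟩ := hu l
    rw [hu, ← hcol]
    refine Submodule.smul_mem _ _ (mem_lattice.2 ⟨Pi.single l 1, fun i => ?_, ?_⟩)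
    · rcases eq_or_ne i l with rfl | h
      · simp [one_mem]
      · simp [h, zero_mem]
    · rw [Matrix.mulVec_single_one]
      rfl
  · refine lattice_le_of_col fun j => ?_
    rw [hcol]
    obtain ⟨u, hu⟩ := hu j
    have h1 : ι (ab j : Fin d → 𝒪[F]) ∈ lattice g := by
      obtain ⟨v, hv⟩ := (ab j).2
      rw [← hv]
      refine mem_lattice.2 ⟨ι v, fun i => (v i).2, ?_⟩
      ext i
      have : ι (A.mulVecLin v) i = ((A.mulVec v i : 𝒪[F]) : F) := rfl
      rw [this]
      simp only [Matrix.mulVec, dotProduct]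
      rw [AddSubmonoidClass.coe_finsetSum]
      rfl
    have h2 := (lattice g).smul_mem ((u⁻¹ : 𝒪[F]ˣ) : 𝒪[F]) h1
    rwa [hu, smul_smul, Units.inv_mul, one_smul] at h2

/-- Elementary divisors: up to the action of `GL_d(𝒪)` every lattice is diagonal. -/
lemma exists_smith (ϖ : Uniformizer F) (g : GeneralLinearGroup (Fin d) F) :
    ∃ (k : GeneralLinearGroup (Fin d) 𝒪[F]) (e : Fin d → ℤ),
      lattice g = lattice (GeneralLinearGroup.map (algebraMap 𝒪[F] F) k * dz ϖ e) := by
  obtain ⟨n, hn⟩ := exists_sc_mul_integral ϖ g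
  obtain ⟨k, e, h⟩ := exists_smith_of_integral ϖ hn
  refine ⟨k, fun i => -n + e i, ?_⟩
  rw [← sc_mul_dz, ← mul_assoc, ← sc_mul_comm, mul_assoc, ← lattice_mul_eq_mul (k := sc ϖ d n),
    h, ← mul_assoc (sc ϖ d n), sc_mul_sc, add_neg_cancel, sc_zero, one_mul]

/-- If `L' ⊆ L` has colength one, then any element of `L \ L'` generates `L / L'`. -/
lemma exists_sub_smul_mem (ϖ : Uniformizer F) {g h : GeneralLinearGroup (Fin d) F}
    (hle : lattice g ≤ lattice h) (hord : gord g = gord h + 1) {f v : Fin d → F}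
    (hf : f ∈ lattice h) (hf' : f ∉ lattice g) (hv : v ∈ lattice h) :
    ∃ c ∈ 𝒪[F], v - c • f ∈ lattice g := by
  -- In a basis adapted to both lattices the relative exponents `e` are nonnegative with sum `1`: a
  -- single `e p` is `1`, the others vanish.
  obtain ⟨k, e, hk⟩ := exists_smith ϖ (h⁻¹ * g)
  set K := GeneralLinearGroup.map (algebraMap 𝒪[F] F) k with hK
  have hg : lattice g = lattice (h * K * dz ϖ e) := by
    rw [← lattice_mul_eq_mul (k := h⁻¹), hk]
    congr 1
    group
  have hh : lattice h = lattice (h * K * dz ϖ (0 : Fin d → ℤ)) := by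
    refine (lattice_eq_of_le ϖ (lattice_le_iff.2 fun i j => ?_) ?_).symm
    · rw [show h⁻¹ * (h * K * dz ϖ (0 : Fin d → ℤ)) = K * sc ϖ d 0 by
        rw [mul_assoc, inv_mul_cancel_left]; rfl, sc_zero, mul_one]
      exact map_integral _ _ _
    · rw [gord_mul, gord_mul, hK, gord_map, gord_dz]
      simp
  rw [hg, hh, lattice_mul_le_mul, lattice_dz_le_dz] at hle
  have hsum : ∑ i, e i = 1 := by
    rw [gord_eq_of_lattice_eq hg, gord_mul, gord_mul, hK, gord_map, gord_dz] at hord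
    omega
  obtain ⟨p, hp⟩ : ∃ p, 0 < e p := by
    by_contra! H
    have := Finset.sum_nonpos fun i (_ : i ∈ Finset.univ) => H i
    omega
  have hp1 : e p + ∑ i ∈ Finset.univ.erase p, e i = 1 := by
    rw [Finset.add_sum_erase _ _ (Finset.mem_univ p), hsum]
  have hq : ∀ q, q ≠ p → e q = 0 := fun q hqp => by
    have h1 := Finset.single_le_sum (f := e) (fun i _ => hle i)
      (Finset.mem_erase.2 ⟨hqp, Finset.mem_univ q⟩)
    have := hle q
    simp only [Pi.zero_apply] at this
    omega
  have hep : e p = 1 := by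
    rw [Finset.sum_eq_zero fun i hi => hq i (Finset.ne_of_mem_erase hi)] at hp1
    omega
  -- The smaller lattice is cut out of the larger one by the condition that the adapted coordinate
  -- `φ` be divisible by `ϖ`. Hence `φ f` is a unit and `c = φ v / φ f` works.
  let φ : (Fin d → F) →ₗ[F] F := (LinearMap.proj p).comp ((h * K)⁻¹).val.mulVecLin
  have hmem : ∀ (e : Fin d → ℤ) (x : Fin d → F), x ∈ lattice (h * K * dz ϖ e) ↔
      ∀ i, ((ϖ.unit ^ (-e i) : Fˣ) : F) * ((h * K)⁻¹).val.mulVec x i ∈ 𝒪[F] := fun e x => by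
    rw [mem_lattice_iff_inv, mul_inv_rev, Units.val_mul, dz_inv_val]
    simp only [← Matrix.mulVec_mulVec, Matrix.mulVec_diagonal]
  have hint : ∀ x ∈ lattice h, ∀ i, ((h * K)⁻¹).val.mulVec x i ∈ 𝒪[F] := fun x hx i => by
    rw [hh, hmem] at hx
    simpa using hx i
  have hφ : ∀ x ∈ lattice h, (x ∈ lattice g ↔ ((ϖ.unit ^ (-1 : ℤ) : Fˣ) : F) * φ x ∈ 𝒪[F]) :=
    fun x hx => by
      rw [hg, hmem]
      constructor
      · intro H
        have := H p
        rwa [hep] at this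
      · intro H i
        rcases eq_or_ne i p with rfl | hi
        · rw [hep]; exact H
        · rw [hq i hi, neg_zero, zpow_zero, Units.val_one, one_mul]
          exact hint x hx i
  rw [hφ f hf] at hf'
  have hf0 : φ f ≠ 0 := fun h0 => hf' (by rw [h0, mul_zero]; exact zero_mem _)
  have hfi := (inv_mem_or_mem ϖ hf0).resolve_right hf'
  have hc : φ v * (φ f)⁻¹ ∈ 𝒪[F] := mul_mem (hint v hv p) hfi
  refine ⟨φ v * (φ f)⁻¹, hc, (hφ _ ?_).2 ?_⟩
  · exact (lattice h).sub_mem hv ((lattice h).smul_mem (⟨_, hc⟩ : 𝒪[F]) hf)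
  · rw [map_sub, map_smul, smul_eq_mul, mul_assoc, inv_mul_cancel₀ hf0, mul_one, sub_self, mul_zero]
    exact zero_mem _

/-! ### The Cartan decomposition -/

lemma exists_perm_le {n : ℕ} (m : Fin n) (σ : Equiv.Perm (Fin n)) : ∃ j, m ≤ j ∧ σ j ≤ m := by
  by_contra! H
  have h1 : (Finset.Ici m).image σ ⊆ Finset.Ioi m := fun i hi => by
    obtain ⟨j, hj, rfl⟩ := Finset.mem_image.1 hi
    exact Finset.mem_Ioi.2 (H j (Finset.mem_Ici.1 hj))
  have h2 := Finset.card_le_card h1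
  rw [Finset.card_image_of_injective _ σ.injective, Fin.card_Ici, Fin.card_Ioi] at h2
  omega

/-- If `e m < f m`, monotonicity makes the whole block of entries of `k` in rows `≤ m` and columns
`≥ m` divisible by `ϖ`. This block is too large to be avoided by a permutation (`exists_perm_le`),
so `ϖ` divides every Leibniz term and `det k` is not a unit. -/
lemma le_of_lattice_mul_dz_le (ϖ : Uniformizer F) {k : GeneralLinearGroup (Fin d) F}
    (hk : ∀ i j, k.val i j ∈ 𝒪[F]) (hk0 : gord k = 0) {e f : Fin d → ℤ} (he : Antitone e)
    (hf : Antitone f) (H : lattice (k * dz ϖ e) ≤ lattice (dz ϖ f)) (m : Fin d) : f m ≤ e m := by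
  by_contra! hm
  rw [lattice_mul_dz_le_dz] at H
  have key : ∀ i j, i ≤ m → m ≤ j → ((ϖ.unit ^ (-1 : ℤ) : Fˣ) : F) * k.val i j ∈ 𝒪[F] := by
    intro i j hi hj
    have h1 := H i j
    have h2 := he hj
    have h3 := hf hi
    have h4 := mul_mem (unit_zpow_mem ϖ (n := f i - e j - 1) (by omega)) h1
    rw [mul_comm (k.val i j), ← mul_assoc, ← Units.val_mul, ← zpow_add] at h4
    rwa [show f i - e j - 1 + (e j - f i) = -1 by ring] at h4
  have hdet : ((ϖ.unit ^ (-1 : ℤ) : Fˣ) : F) * k.val.det ∈ 𝒪[F] := by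
    rw [Matrix.det_apply, Finset.mul_sum]
    refine sum_mem fun σ _ => ?_
    rw [Units.smul_def, mul_smul_comm]
    refine zsmul_mem ?_ _
    obtain ⟨j, hj, hσ⟩ := exists_perm_le m σ
    rw [← Finset.mul_prod_erase _ _ (Finset.mem_univ j), ← mul_assoc]
    exact mul_mem (key _ _ hσ hj) (prod_mem fun i _ => hk _ _)
  have h5 := ord_nonneg (mul_ne_zero (Units.ne_zero _) k.det_ne_zero) hdet
  rw [ord_mul (Units.ne_zero _) k.det_ne_zero, ord_unit_zpow] at h5
  have h6 : ord k.val.det = 0 := hk0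
  omega

lemma eq_of_lattice_mul_dz_eq (ϖ : Uniformizer F) (k : GeneralLinearGroup (Fin d) 𝒪[F])
    {e f : Fin d → ℤ} (he : Antitone e) (hf : Antitone f)
    (H : lattice (GeneralLinearGroup.map (algebraMap 𝒪[F] F) k * dz ϖ e) = lattice (dz ϖ f)) :
    e = f := by
  funext m
  refine le_antisymm ?_ (le_of_lattice_mul_dz_le ϖ (map_integral k) (gord_map k) he hf H.le m)
  refine le_of_lattice_mul_dz_le ϖ (map_integral k⁻¹) (gord_map k⁻¹) hf he ?_ m
  rw [← lattice_mul_le_mul (k := GeneralLinearGroup.map (algebraMap 𝒪[F] F) k),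
    GeneralLinearGroup.map_inv, mul_inv_cancel_left]
  exact H.ge

lemma exists_vtx_eq (v : Vertex F d) : ∃ g, v = vtx g := by
  obtain ⟨p, rfl⟩ := QuotientGroup.mk_surjective v
  obtain ⟨g, rfl⟩ := QuotientGroup.mk_surjective p
  refine ⟨g, ?_⟩
  change _ = ((toPGL g * 1 : PGL F d) : Vertex F d)
  rw [mul_one]
  rfl

/-- The class in `PGL_d(F)` of a matrix in `GL_d(𝒪)`. -/
noncomputable def intPGL (k : GeneralLinearGroup (Fin d) 𝒪[F]) : PGL F d :=
  toPGL (GeneralLinearGroup.map (algebraMap 𝒪[F] F) k)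

lemma intPGL_mem (k : GeneralLinearGroup (Fin d) 𝒪[F]) : intPGL k ∈ maxCompact F d := ⟨k, rfl⟩

/-- The sum `x_i + ⋯ + x_{d-1}` (with zero-based index `i`). -/
def tailSum (x : Fin (d - 1) → ℕ) (i : ℕ) : ℕ := ∑ k : Fin (d - 1) with i ≤ k.val, x k

lemma tailSum_succ (x : Fin (d - 1) → ℕ) {i : ℕ} (hi : i < d - 1) :
    tailSum x i = x ⟨i, hi⟩ + tailSum x (i + 1) := by
  unfold tailSum
  rw [← Finset.add_sum_erase _ _ (a := (⟨i, hi⟩ : Fin (d - 1))) (by simp)]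
  congr 2
  ext k
  simp only [Finset.mem_erase, Finset.mem_filter, Finset.mem_univ, true_and, ne_eq, Fin.ext_iff]
  omega

lemma tailSum_eq_zero (x : Fin (d - 1) → ℕ) {i : ℕ} (hi : d - 1 ≤ i) : tailSum x i = 0 := by
  refine Finset.sum_eq_zero fun k hk => ?_
  have := k.2
  simp only [Finset.mem_filter] at hk
  omega

lemma tailSum_antitone (x : Fin (d - 1) → ℕ) : Antitone (tailSum x) := fun i j hij =>
  Finset.sum_le_sum_of_subset fun k hk => by
    simp only [Finset.mem_filter] at hk ⊢
    exact ⟨hk.1, hij.trans hk.2⟩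

lemma sectorVertex_eq (ϖ : Uniformizer F) (x : Fin (d - 1) → ℕ) :
    sectorVertex ϖ d x = vtx (dz ϖ fun i => (tailSum x i : ℤ)) := by
  unfold sectorVertex dz tailSum
  simp only [zpow_natCast]

lemma sectorOrbit_injective (ϖ : Uniformizer F) (hd : 2 ≤ d) :
    Function.Injective (sectorOrbit ϖ d) := by
  intro x y hxy
  obtain ⟨⟨_, k, rfl⟩, hk⟩ := MulAction.orbitRel_apply.1 (Quotient.exact hxy)
  have h1 : vtx (GeneralLinearGroup.map (algebraMap 𝒪[F] F) k *
      dz ϖ fun i => (tailSum y i : ℤ)) = vtx (dz ϖ fun i => (tailSum x i : ℤ)) := by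
    rw [vtx_mul, ← sectorVertex_eq, ← sectorVertex_eq]
    exact hk
  obtain ⟨n, hn⟩ := exists_lattice_eq_of_vtx_eq ϖ h1.symm
  rw [sc_mul_dz] at hn
  have h2 := eq_of_lattice_mul_dz_eq ϖ k
    (fun i j hij => by exact_mod_cast tailSum_antitone y (show i.val ≤ j.val from hij))
    (fun i j hij => by
      have := tailSum_antitone x (show i.val ≤ j.val from hij)
      omega) hn
  -- Both exponent vectors end in `0`, so the last coordinate forces the homothety exponent `n` to
  -- vanish.
  have h3 := congrFun h2 ⟨d - 1, by omega⟩
  simp only [tailSum_eq_zero _ le_rfl] at h3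
  have h4 : ∀ i < d, tailSum x i = tailSum y i := fun i hi => by
    have := congrFun h2 ⟨i, hi⟩
    simp only at this
    omega
  funext i
  have h5 := h4 i (by omega)
  have h6 := h4 (i + 1) (by omega)
  rw [tailSum_succ x i.2, tailSum_succ y i.2] at h5
  simp only [Fin.eta] at h5
  omega

lemma exists_sort (ϖ : Uniformizer F) (e : Fin d → ℤ) :
    ∃ (k : GeneralLinearGroup (Fin d) 𝒪[F]) (f : Fin d → ℤ), Antitone f ∧
      lattice (GeneralLinearGroup.map (algebraMap 𝒪[F] F) k * dz ϖ f) = lattice (dz ϖ e) := by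
  let σ := Tuple.sort fun i => -e i
  have hσ : Antitone (e ∘ σ) := fun i j hij => by
    have := Tuple.monotone_sort (fun i => -e i) hij
    simp only [Function.comp_apply] at this
    simp only [Function.comp_apply, σ]
    omega
  let P : Matrix (Fin d) (Fin d) 𝒪[F] := (1 : Matrix (Fin d) (Fin d) 𝒪[F]).submatrix id σ
  have hP : IsUnit P.det := by
    rw [Matrix.det_permute', Matrix.det_one, mul_one]
    exact Units.isUnit ((Units.map (Int.castRingHom 𝒪[F] : ℤ →* 𝒪[F])) (Equiv.Perm.sign σ))
  refine ⟨GeneralLinearGroup.mk'' P hP, e ∘ σ, hσ, lattice_eq_of_le ϖ ?_ ?_⟩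
  · rw [lattice_mul_dz_le_dz]
    intro i j
    rw [show (GeneralLinearGroup.map (algebraMap 𝒪[F] F) (GeneralLinearGroup.mk'' P hP)).val i j
      = (((1 : Matrix (Fin d) (Fin d) 𝒪[F]) i (σ j) : 𝒪[F]) : F) from rfl]
    rcases eq_or_ne i (σ j) with rfl | h
    · simp [one_mem]
    · simp [Matrix.one_apply_ne h, zero_mem]
  · rw [gord_mul, gord_map, zero_add, gord_dz, gord_dz]
    exact Equiv.sum_comp σ e

lemma exists_tailSum_eq (hd : 2 ≤ d) {f : Fin d → ℤ} (hf : Antitone f) :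
    ∃ (x : Fin (d - 1) → ℕ) (n : ℤ), f = fun i : Fin d => n + (tailSum x i : ℤ) := by
  let x : Fin (d - 1) → ℕ := fun i => (f ⟨i, by omega⟩ - f ⟨i + 1, by omega⟩).toNat
  refine ⟨x, f ⟨d - 1, by omega⟩, ?_⟩
  have key : ∀ (m i : ℕ) (hi : i < d), i + m = d - 1 →
      f ⟨i, hi⟩ = f ⟨d - 1, by omega⟩ + (tailSum x i : ℤ) := by
    intro m
    induction m with
    | zero =>
      intro i hi h
      obtain rfl : i = d - 1 := by omega
      rw [tailSum_eq_zero x le_rfl]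
      simp
    | succ m ih =>
      intro i hi h
      have h1 := ih (i + 1) (by omega) (by omega)
      have h2 : f ⟨i + 1, by omega⟩ ≤ f ⟨i, hi⟩ := hf (by simp [Fin.le_def])
      rw [tailSum_succ x (by omega)]
      have h3 : ((x ⟨i, by omega⟩ : ℕ) : ℤ) = f ⟨i, hi⟩ - f ⟨i + 1, by omega⟩ :=
        Int.toNat_of_nonneg (sub_nonneg.2 h2)
      push_cast
      omega
  funext i
  exact key (d - 1 - i) i i.2 (by omega)

lemma sectorOrbit_surjective (ϖ : Uniformizer F) (hd : 2 ≤ d) :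
    Function.Surjective (sectorOrbit ϖ d) := by
  intro o
  obtain ⟨v, rfl⟩ := Quotient.mk''_surjective o
  obtain ⟨g, rfl⟩ := exists_vtx_eq v
  obtain ⟨k, e, hk⟩ := exists_smith ϖ g
  obtain ⟨k', f, hf, hk'⟩ := exists_sort ϖ e
  obtain ⟨x, n, rfl⟩ := exists_tailSum_eq hd hf
  refine ⟨x, (Quotient.sound (MulAction.orbitRel_apply.2
    ⟨⟨_, intPGL_mem (k * k')⟩, ?_⟩)).symm⟩
  change intPGL (k * k') • sectorVertex ϖ d x = vtx g
  rw [sectorVertex_eq, ← vtx_dz_add_const ϖ n, intPGL, ← vtx_mul]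
  refine vtx_eq_of_lattice_eq ϖ ?_
  rw [hk, GeneralLinearGroup.map_mul, mul_assoc, lattice_mul_eq_mul, hk']

lemma cartanProj_preimage (ϖ : Uniformizer F) (hd : 2 ≤ d) (x : Fin (d - 1) → ℕ) :
    cartanProj ϖ d ⁻¹' {x} =
      {v | ∃ k : GeneralLinearGroup (Fin d) 𝒪[F], v = intPGL k • sectorVertex ϖ d x} := by
  have hb : Function.Bijective (sectorOrbit ϖ d) :=
    ⟨sectorOrbit_injective ϖ hd, sectorOrbit_surjective ϖ hd⟩
  ext v
  have h1 : cartanProj ϖ d v = x ↔ Quotient.mk'' v = sectorOrbit ϖ d x := by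
    constructor
    · rintro rfl
      exact (Function.rightInverse_invFun hb.2 _).symm
    · intro h
      unfold cartanProj
      rw [h]
      exact Function.leftInverse_invFun hb.1 x
  rw [Set.mem_preimage, Set.mem_singleton_iff, h1]
  constructor
  · intro h
    obtain ⟨⟨_, k, rfl⟩, hk⟩ := MulAction.orbitRel_apply.1 (Quotient.exact h)
    exact ⟨k, hk.symm⟩
  · rintro ⟨k, rfl⟩
    exact Quotient.sound (MulAction.orbitRel_apply.2 ⟨⟨_, intPGL_mem k⟩, rfl⟩)

/-! ### Cells of type one and lattice chains -/

/-- Representatives `g₀ 𝒪^d ⊇ ⋯ ⊇ g_j 𝒪^d ⊇ ϖ g₀ 𝒪^d` of a cell of type one, with steps of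
colength one. -/
structure TypeOneChain (ϖ : Uniformizer F) {j : ℕ} (g : Fin (j + 1) → GeneralLinearGroup (Fin d) F) :
    Prop where
  antitone : Antitone fun i => lattice (g i)
  gord_eq : ∀ i, gord (g i) = gord (g 0) + (i.val : ℤ)
  wrap : lattice (sc ϖ d 1 * g 0) ≤ lattice (g (Fin.last j))

lemma TypeOneChain.mul_left {ϖ : Uniformizer F} {j : ℕ}
    {g : Fin (j + 1) → GeneralLinearGroup (Fin d) F} (hg : TypeOneChain ϖ g)
    (k : GeneralLinearGroup (Fin d) F) : TypeOneChain ϖ fun i => k * g i where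
  antitone i i' h := lattice_mul_le_mul.2 (hg.antitone h)
  gord_eq i := by rw [gord_mul, gord_mul, hg.gord_eq i, add_assoc]
  wrap := by
    rw [← mul_assoc, sc_mul_comm, mul_assoc, lattice_mul_le_mul]
    exact hg.wrap

lemma TypeOneChain.tail {ϖ : Uniformizer F} {j : ℕ}
    {g : Fin (j + 1 + 1) → GeneralLinearGroup (Fin d) F} (hg : TypeOneChain ϖ g) :
    TypeOneChain ϖ fun i : Fin (j + 1) => g i.succ where
  antitone i i' h := hg.antitone (Fin.succ_le_succ_iff.2 h)
  gord_eq i := by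
    rw [hg.gord_eq i.succ, hg.gord_eq (Fin.succ 0)]
    simp only [Fin.val_succ, Fin.val_zero]
    push_cast
    ring
  wrap := (lattice_mul_le_mul.2 (hg.antitone (Fin.zero_le _))).trans hg.wrap

lemma TypeOneChain.isTypeOne {ϖ : Uniformizer F} {j : ℕ} (hj : j < d)
    {g : Fin (j + 1) → GeneralLinearGroup (Fin d) F} (hg : TypeOneChain ϖ g) :
    IsTypeOne ϖ fun i => vtx (g i) := by
  refine ⟨⟨g, rfl, fun i i' h => lt_of_le_of_ne (hg.antitone h.le) fun H => ?_, ?_⟩, fun i => ?_⟩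
  · have h1 := gord_eq_of_lattice_eq H
    rw [hg.gord_eq i, hg.gord_eq i'] at h1
    have h2 : i.val < i'.val := h
    omega
  -- The wrap-around inclusion has colength `d - j`, so it is strict because `j < d`.
  · rw [smul_lattice]
    refine lt_of_le_of_ne hg.wrap fun H => ?_
    have h1 := gord_eq_of_lattice_eq H
    rw [hg.gord_eq (Fin.last j), gord_mul, gord_sc, Fin.val_last] at h1
    omega
  · rw [col_vtx, col_vtx]
    change ((gord (g i.succ) : ℤ) : ZMod d) = ((gord (g i.castSucc) : ℤ) : ZMod d) + 1
    rw [hg.gord_eq, hg.gord_eq i.castSucc, Fin.val_succ, Fin.val_castSucc]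
    push_cast
    ring

lemma wrap_le_of_strictAnti {ϖ : Uniformizer F} {r : ℕ}
    {γ : Fin (r + 1) → GeneralLinearGroup (Fin d) F} (hγ : StrictAnti fun i => lattice (γ i))
    (hlast : ϖ.val • lattice (γ 0) < lattice (γ (Fin.last r))) (a b : Fin (r + 1)) :
    lattice (sc ϖ d 1 * γ a) < lattice (γ b) := by
  rw [smul_lattice] at hlast
  exact ((lattice_mul_le_mul.2 (hγ.antitone (Fin.zero_le a))).trans_lt hlast).trans_le
    (hγ.antitone (Fin.le_last b))

/-- The definition of a cell enumerates the vertices in some order and with an arbitrary starting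
point. Since the lattices of a cell form a chain that is periodic under `ϖ`, the chain can be
rotated to start at `σ 0`; the colors then force the order and the colengths. -/
lemma IsTypeOne.exists_chain {ϖ : Uniformizer F} {j : ℕ} (hj : j < d)
    {σ : Fin (j + 1) → Vertex F d} (hσ : IsTypeOne ϖ σ) :
    ∃ g : Fin (j + 1) → GeneralLinearGroup (Fin d) F,
      TypeOneChain ϖ g ∧ ∀ i, σ i = vtx (g i) := by
  obtain ⟨⟨γ, hrange, hγ, hlast⟩, hcol⟩ := hσ
  have hw := wrap_le_of_strictAnti hγ hlast
  have hπ : ∀ i, ∃ p, vtx (γ p) = σ i := fun i => by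
    have : σ i ∈ Set.range fun i => vtx (γ i) := hrange ▸ ⟨i, rfl⟩
    exact this
  choose π hπ using hπ
  -- Rotation: lattices strictly larger than the one of `σ 0` are multiplied by `ϖ`, which moves
  -- them below it.
  let n : Fin (j + 1) → ℤ := fun i => if π i < π 0 then 1 else 0
  let g : Fin (j + 1) → GeneralLinearGroup (Fin d) F := fun i => sc ϖ d (n i) * γ (π i)
  have hn0 : ∀ i, ¬ π i < π 0 → g i = γ (π i) := fun i hi => by
    simp only [g, n, if_neg hi, sc_zero, one_mul]
  have hn1 : ∀ i, π i < π 0 → g i = sc ϖ d 1 * γ (π i) := fun i hi => by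
    simp only [g, n, if_pos hi]
  have hg0 : g 0 = γ (π 0) := hn0 0 (lt_irrefl _)
  have hvtx : ∀ i, σ i = vtx (g i) := fun i => by rw [← hπ, vtx_sc_mul]
  have hlow : ∀ i, lattice (g i) ≤ lattice (g 0) := fun i => by
    rw [hg0]
    by_cases hi : π i < π 0
    · rw [hn1 i hi]; exact (hw _ _).le
    · rw [hn0 i hi]; exact hγ.antitone (not_lt.1 hi)
  have hup : ∀ i, lattice (sc ϖ d 1 * g 0) < lattice (g i) := fun i => by
    rw [hg0]
    by_cases hi : π i < π 0
    · rw [hn1 i hi]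
      exact lt_of_le_not_ge (lattice_mul_le_mul.2 (hγ hi).le)
        fun h => (hγ hi).not_ge (lattice_mul_le_mul.1 h)
    · rw [hn0 i hi]; exact hw _ _
  have hcomp : ∀ i i', lattice (g i) ≤ lattice (g i') ∨ lattice (g i') ≤ lattice (g i) := by
    intro i i'
    by_cases hi : π i < π 0 <;> by_cases hi' : π i' < π 0
    · rw [hn1 i hi, hn1 i' hi', lattice_mul_le_mul, lattice_mul_le_mul]
      exact (le_total (π i') (π i)).imp (fun h => hγ.antitone h) (fun h => hγ.antitone h)
    · rw [hn1 i hi, hn0 i' hi']; exact .inl (hw _ _).le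
    · rw [hn0 i hi, hn1 i' hi']; exact .inr (hw _ _).le
    · rw [hn0 i hi, hn0 i' hi']
      exact (le_total (π i') (π i)).imp (fun h => hγ.antitone h) (fun h => hγ.antitone h)
  have hcol' : ∀ (m : ℕ) (hm : m < j + 1), col (σ ⟨m, hm⟩) = col (σ 0) + m := by
    intro m
    induction m with
    | zero => intro hm; simp
    | succ m ih =>
      intro hm
      have h1 := hcol ⟨m, by omega⟩
      have h2 := ih (by omega)
      simp only [Fin.succ_mk, Fin.castSucc_mk] at h1
      rw [h1, h2]
      push_cast
      ring
  have hgord : ∀ i, gord (g i) = gord (g 0) + (i.val : ℤ) := fun i => by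
    have h1 := hcol' i i.2
    rw [Fin.eta, hvtx i, hvtx 0, col_vtx, col_vtx] at h1
    change ((gord (g i) : ℤ) : ZMod d) = ((gord (g 0) : ℤ) : ZMod d) + _ at h1
    have h2 := gord_le_of_lattice_le (hlow i)
    have h3 := gord_le_of_lattice_le (hup i).le
    have h4 : gord (g i) ≠ gord (sc ϖ d 1 * g 0) := fun h =>
      (hup i).ne (lattice_eq_of_le ϖ (hup i).le h.symm)
    rw [gord_mul (sc ϖ d 1) (g 0), gord_sc] at h3 h4
    -- Colors determine the colength of `g i` in `g 0` modulo `d`. It lies in `[0, d)` by the strict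
    -- inclusion `hup`, and so does `i`, hence they agree.
    have h5 : (((gord (g i) - gord (g 0) - (i.val : ℤ) : ℤ)) : ZMod d) = 0 := by
      push_cast
      rw [h1]
      ring
    rw [ZMod.intCast_zmod_eq_zero_iff_dvd] at h5
    have h6 := i.2
    have h7 := Int.eq_zero_of_abs_lt_dvd h5 (abs_lt.2 ⟨by omega, by omega⟩)
    omega
  refine ⟨g, ⟨fun i i' h => ?_, hgord, (hup _).le⟩, hvtx⟩
  rcases hcomp i' i with h1 | h1
  · exact h1
  · have h2 := gord_le_of_lattice_le h1
    rw [hgord i, hgord i'] at h2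
    have h3 : i.val ≤ i'.val := h
    obtain rfl : i = i' := Fin.ext (by omega)
    exact le_rfl

/-- The representatives of a cell of type one may be normalized at one vertex. -/
lemma IsTypeOne.exists_chain_of_vtx {ϖ : Uniformizer F} {j : ℕ} (hj : j < d)
    {σ : Fin (j + 1) → Vertex F d} (hσ : IsTypeOne ϖ σ) (i : Fin (j + 1))
    {h : GeneralLinearGroup (Fin d) F} (hi : σ i = vtx h) :
    ∃ g : Fin (j + 1) → GeneralLinearGroup (Fin d) F,
      TypeOneChain ϖ g ∧ (∀ i, σ i = vtx (g i)) ∧ lattice (g i) = lattice h := by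
  obtain ⟨g, hg, hv⟩ := hσ.exists_chain hj
  obtain ⟨n, hn⟩ := exists_lattice_eq_of_vtx_eq ϖ ((hv i).symm.trans hi)
  exact ⟨_, hg.mul_left (sc ϖ d n), fun i => by rw [vtx_sc_mul, hv], hn.symm⟩

/-- The necessary condition for two vertices to lie in one cell; it is what rules out a cell
containing both ends of a geodesic step. -/
lemma IsCell.exists_wrap {ϖ : Uniformizer F} {s : Set (Vertex F d)} (hs : IsCell ϖ s)
    {g h : GeneralLinearGroup (Fin d) F} (hg : vtx g ∈ s) (hh : vtx h ∈ s) :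
    ∃ n : ℤ, lattice (sc ϖ d n * h) ≤ lattice g ∧
      lattice (sc ϖ d 1 * g) ≤ lattice (sc ϖ d n * h) := by
  obtain ⟨r, γ, rfl, hγ, hlast⟩ := hs
  have hw := wrap_le_of_strictAnti hγ hlast
  obtain ⟨a, ha⟩ := hg
  obtain ⟨b, hb⟩ := hh
  obtain ⟨m, hm⟩ := exists_lattice_eq_of_vtx_eq ϖ ha
  obtain ⟨m', hm'⟩ := exists_lattice_eq_of_vtx_eq ϖ hb
  have e1 : lattice (sc ϖ d 1 * g) = lattice (sc ϖ d m * (sc ϖ d 1 * γ a)) := by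
    rw [← mul_assoc, sc_mul_sc, add_comm, ← sc_mul_sc, mul_assoc, lattice_mul_eq_mul, hm]
  have e2 : ∀ q : ℤ, lattice (sc ϖ d (m - m' + q) * h) =
      lattice (sc ϖ d m * (sc ϖ d q * γ b)) := fun q => by
    have : lattice (sc ϖ d (m - m' + q) * h) = lattice (sc ϖ d (m - m' + q) *
      (sc ϖ d m' * γ b)) := lattice_mul_eq_mul.2 hm'
    rw [this, ← mul_assoc, ← mul_assoc, sc_mul_sc, sc_mul_sc]
    congr 3
    ring
  -- The shift `m - m'` compares the given representatives with those of the chain; one more factor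
  -- `ϖ` is needed when `h` precedes `g` in the chain.
  rcases le_or_gt a b with hab | hab
  · refine ⟨m - m' + 0, ?_, ?_⟩
    · rw [e2, hm, lattice_mul_le_mul, sc_zero, one_mul]
      exact hγ.antitone hab
    · rw [e2, e1, lattice_mul_le_mul, sc_zero, one_mul]
      exact (hw _ _).le
  · refine ⟨m - m' + 1, ?_, ?_⟩
    · rw [e2, hm, lattice_mul_le_mul]
      exact (hw _ _).le
    · rw [e2, e1, lattice_mul_le_mul, lattice_mul_le_mul]
      exact hγ.antitone hab.le

end LocalField

/-! ### Standard geodesics in the standard apartment -/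

/-- The exponents of the `t`-th vertex of the standard geodesic which, with period `j`, increases
the exponents at the positions `j - 1, …, 1, 0` (zero-based), with exponents `a` at time `0`. -/
def stdExp {d : ℕ} (j : ℕ) (a : Fin d → ℤ) (t : ℤ) : Fin d → ℤ :=
  fun k => a k + if k.val < j then (t + k.val) / j else 0

section Exponents

variable {d j : ℕ} (a : Fin d → ℤ)

lemma stdExp_of_le (t : ℤ) {k : Fin d} (hk : j ≤ k.val) : stdExp j a t k = a k := by
  simp [stdExp, not_lt.2 hk]

lemma stdExp_add_period (t : ℤ) (k : Fin d) :
    stdExp j a (t + j) k = stdExp j a t k + if k.val < j then 1 else 0 := by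
  unfold stdExp
  split_ifs with h
  · rw [add_right_comm, Int.add_ediv_of_dvd_right (dvd_refl _), Int.ediv_self (by omega)]
    ring
  · ring

lemma stdExp_monotone (k : Fin d) : Monotone fun t => stdExp j a t k := by
  intro t t' h
  simp only [stdExp]
  split_ifs
  · have := Int.ediv_le_ediv (c := (j : ℤ)) (by omega) (show t + k.val ≤ t' + k.val by omega)
    omega
  · exact le_rfl

lemma stdExp_step (hj : 1 ≤ j) (hjd : j ≤ d) (t : ℤ) : ∃ p : Fin d, p.val < j ∧
    ∀ k, stdExp j a (t + 1) k = stdExp j a t k + if k = p then 1 else 0 := by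
  have hj0 : (0 : ℤ) < j := by omega
  have h1 := Int.emod_nonneg t hj0.ne'
  have h2 := Int.emod_lt_of_pos t hj0
  have h3 := Int.emod_add_mul_ediv t j
  -- The quotient `(t + k) / j` jumps between `t` and `t + 1` exactly when `j` divides `t + 1 + k`,
  -- which for `0 ≤ k < j` means `k = j - 1 - t % j`.
  refine ⟨⟨(j - 1 - t % j).toNat, by omega⟩, by simp only; omega, fun k => ?_⟩
  by_cases hk : k.val < j
  · simp only [stdExp, if_pos hk, Fin.ext_iff]
    have e : ∀ s r : ℤ, 0 ≤ r → r < j → t % j + s = r → (t + s) / j = t / j := by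
      intro s r h0 hr hs
      rw [Int.ediv_eq_iff_of_pos hj0]
      constructor <;> nlinarith
    have e' : ∀ s r : ℤ, 0 ≤ r → r < j → t % j + s = j + r → (t + s) / j = t / j + 1 := by
      intro s r h0 hr hs
      rw [Int.ediv_eq_iff_of_pos hj0]
      constructor <;> nlinarith
    by_cases hc : k.val = (j - 1 - t % j).toNat
    · rw [if_pos hc, add_assoc t, e' (1 + k.val) 0 le_rfl hj0 (by omega),
        e k.val (j - 1) (by omega) (by omega) (by omega)]
      ring
    · rw [if_neg hc, add_assoc t, add_zero]
      congr 1
      by_cases hlt : t % j + k.val < j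
      · rw [e (1 + k.val) (t % j + k.val + 1) (by omega) (by omega) (by omega),
          e k.val (t % j + k.val) (by omega) (by omega) (by omega)]
      · rw [e' (1 + k.val) (t % j + k.val + 1 - j) (by omega) (by omega) (by omega),
          e' k.val (t % j + k.val - j) (by omega) (by omega) (by omega)]
  · have : k ≠ ⟨(j - 1 - t % j).toNat, by omega⟩ := by
      intro h
      have := congrArg Fin.val h
      simp only at this
      omega
    simp [stdExp, hk, this]

/-- After `n` full periods the geodesic can be restarted at time `0` with new initial exponents;
this links the flow in one dimension to the next raising of dimension. -/
lemma stdExp_add_mul_period (t : ℤ) (n : ℕ) :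
    stdExp j a (j * n + t) = stdExp j (fun k => a k + if k.val < j then (n : ℤ) else 0) t := by
  funext k
  unfold stdExp
  by_cases h : k.val < j
  · simp only [h, if_true]
    rw [add_assoc, Int.add_ediv_of_dvd_left (dvd_mul_right _ _),
      Int.mul_ediv_cancel_left _ (by omega), add_assoc]
  · simp [h]

/-- The vertices of the cell at time `0` sit at the times `-j, …, 0`, where the formula no longer
depends on `j`. -/
lemma stdExp_neg {s : ℕ} (hs : s ≤ j) (k : Fin d) :
    stdExp j a (-(s : ℤ)) k = a k - if k.val < s then 1 else 0 := by
  unfold stdExp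
  have hk := k.2
  by_cases h : k.val < j
  · rw [if_pos h]
    split_ifs with h'
    · rw [show (-(s : ℤ) + k.val) / j = -1 by
        rw [Int.ediv_eq_iff_of_pos (by omega)]; constructor <;> omega]
      ring
    · rw [show (-(s : ℤ) + k.val) / j = 0 by
        rw [Int.ediv_eq_iff_of_pos (by omega)]; constructor <;> omega]
      ring
  · rw [if_neg h, if_neg (by omega)]
    ring

lemma sum_stdExp (hj : 1 ≤ j) (hjd : j ≤ d) (t : ℤ) (n : ℕ) :
    ∑ k, stdExp j a (t + n) k = ∑ k, stdExp j a t k + n := by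
  induction n with
  | zero => simp
  | succ n ih =>
    obtain ⟨p, -, hp⟩ := stdExp_step a hj hjd (t + n)
    push_cast
    rw [← add_assoc, Finset.sum_congr rfl fun k _ => hp k, Finset.sum_add_distrib, ih,
      Finset.sum_ite_eq' Finset.univ p]
    simp [add_assoc]

end Exponents

section LocalField

set_option linter.unusedSectionVars false

variable {F : Type*} [Field F] [ValuativeRel F] [TopologicalSpace F] [IsNonarchimedeanLocalField F]
variable {d : ℕ} (ϖ : Uniformizer F)

/-- The cell of the standard geodesic at time `t`. -/
noncomputable def stdChain (j : ℕ) (a : Fin d → ℤ) (t : ℤ) :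
    Fin (j + 1) → GeneralLinearGroup (Fin d) F :=
  fun i => dz ϖ (stdExp j a (t - j + i.val))

lemma stdChain_typeOneChain {j : ℕ} (hj : j < d) (a : Fin d → ℤ) (t : ℤ) :
    TypeOneChain ϖ (stdChain ϖ j a t) where
  antitone i i' h := (lattice_dz_le_dz ϖ _ _).2 fun k => stdExp_monotone a k (by
    have : i.val ≤ i'.val := h
    omega)
  gord_eq i := by
    unfold stdChain
    rw [gord_dz, gord_dz]
    rcases Nat.eq_zero_or_pos j with rfl | hj0
    · have : i = 0 := Subsingleton.elim (α := Fin 1) _ _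
      subst this
      simp
    · rw [sum_stdExp a hj0 hj.le]
      simp
  wrap := by
    unfold stdChain
    rw [sc_mul_dz, lattice_dz_le_dz]
    intro k
    rw [Fin.val_last, Fin.val_zero, Nat.cast_zero, add_zero, stdExp_add_period]
    split_ifs <;> omega

/-- The cell of the standard geodesic at time `t`, as an element of `ℬ₁ʲ`. -/
noncomputable def stdCell {j : ℕ} (hj : j < d) (a : Fin d → ℤ) (t : ℤ) : B1 ϖ d j :=
  ⟨fun i => vtx (stdChain ϖ j a t i), (stdChain_typeOneChain ϖ hj a t).isTypeOne hj⟩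

lemma col_mem_lattice (g : GeneralLinearGroup (Fin d) F) (j : Fin d) :
    (fun i => g.val i j) ∈ lattice g :=
  mem_lattice.2 ⟨Pi.single j 1, fun i => by
    rcases eq_or_ne i j with rfl | h
    · simp [one_mem]
    · simp [h, zero_mem], by rw [Matrix.mulVec_single_one]; rfl⟩

lemma single_mem_lattice_dz {e : Fin d → ℤ} {s : Fin d} {n : ℤ} (h : e s ≤ n) :
    (Pi.single s ((ϖ.unit ^ n : Fˣ) : F) : Fin d → F) ∈ lattice (dz ϖ e) := by
  rw [mem_lattice_dz]
  intro i
  rcases eq_or_ne i s with rfl | hi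
  · rw [Pi.single_eq_same, ← Units.val_mul, ← zpow_add]
    exact unit_zpow_mem ϖ (by omega)
  · rw [Pi.single_eq_of_ne hi, mul_zero]
    exact zero_mem _

lemma dz_col (e : Fin d → ℤ) (s : Fin d) :
    (fun i => (dz ϖ e).val i s) = Pi.single s ((ϖ.unit ^ e s : Fˣ) : F) := by
  ext i
  rw [dz_val]
  rcases eq_or_ne i s with rfl | hi
  · rw [Matrix.diagonal_apply_eq, Pi.single_eq_same]
  · rw [Matrix.diagonal_apply_ne _ hi, Pi.single_eq_of_ne hi]

lemma intPGL_smul_vtx_dz (k : GeneralLinearGroup (Fin d) 𝒪[F]) (e : Fin d → ℤ)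
    (h : lattice (GeneralLinearGroup.map (algebraMap 𝒪[F] F) k * dz ϖ e) ≤ lattice (dz ϖ e)) :
    intPGL k • vtx (dz ϖ e) = vtx (dz ϖ e) := by
  rw [intPGL, ← vtx_mul]
  exact vtx_eq_of_lattice_eq ϖ (lattice_eq_of_le ϖ h (by rw [gord_mul, gord_map, zero_add]))

lemma TypeOneChain.cons {ϖ : Uniformizer F} {j : ℕ}
    {g : Fin (j + 1) → GeneralLinearGroup (Fin d) F} (hg : TypeOneChain ϖ g)
    {h : GeneralLinearGroup (Fin d) F} (hle : lattice (g 0) ≤ lattice h)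
    (hord : gord (g 0) = gord h + 1) (hwrap : lattice (sc ϖ d 1 * h) ≤ lattice (g (Fin.last j))) :
    TypeOneChain ϖ (Fin.cons h g : Fin (j + 1 + 1) → GeneralLinearGroup (Fin d) F) where
  antitone := by
    intro i i' hii
    induction i using Fin.cases with
    | zero =>
      induction i' using Fin.cases with
      | zero => exact le_rfl
      | succ i' => exact (hg.antitone (Fin.zero_le i')).trans hle
    | succ i =>
      induction i' using Fin.cases with
      | zero => exact absurd hii (by simp)
      | succ i' => exact hg.antitone (Fin.succ_le_succ_iff.1 hii)
  gord_eq i := by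
    induction i using Fin.cases with
    | zero => simp
    | succ i =>
      rw [Fin.cons_succ, Fin.cons_zero, hg.gord_eq i, hord, Fin.val_succ]
      push_cast
      ring
  wrap := by
    rw [← Fin.succ_last, Fin.cons_succ, Fin.cons_zero]
    exact hwrap

/-! ### The geodesic flow on standard geodesics -/

/-- Between times `t - j` and `t + 1` the position that moves at both ends gains `2`, while the last
position, which is `≥ j`, gains nothing. No rescaling places such exponents within one wrap, so the
two vertices share no cell. -/
lemma stdCell_mem_flow {j : ℕ} (hj : j < d) (hj1 : 1 ≤ j) (a : Fin d → ℤ) (t : ℤ) :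
    stdCell ϖ hj a (t + 1) ∈ flow ϖ d j (stdCell ϖ hj a t) := by
  refine ⟨fun i => ?_, fun hcell => ?_⟩
  · simp only [stdCell, stdChain, Fin.val_castSucc, Fin.val_succ]
    congr 3
    push_cast
    ring
  · obtain ⟨n, h1, h2⟩ := hcell.exists_wrap (g := stdChain ϖ j a t 0)
      (h := stdChain ϖ j a (t + 1) (Fin.last j)) (.inr ⟨0, rfl⟩) (.inl rfl)
    obtain ⟨p, hp, hstep⟩ := stdExp_step a hj1 hj.le (t - j)
    unfold stdChain at h1 h2
    rw [sc_mul_dz, lattice_dz_le_dz] at h1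
    rw [sc_mul_dz, sc_mul_dz, lattice_dz_le_dz] at h2
    have h3 := h1 ⟨d - 1, by omega⟩
    have h4 := h2 p
    simp only [Fin.val_last, Fin.val_zero, Nat.cast_zero, add_zero] at h3 h4
    rw [stdExp_of_le _ _ (by simp only; omega), stdExp_of_le _ _ (by simp only; omega)] at h3
    have h5 := hstep p
    rw [if_pos rfl] at h5
    rw [show t + 1 - (j : ℤ) + j = (t - j + 1) + j by ring, stdExp_add_period, if_pos hp, h5] at h4
    omega

/-- The unipotent matrix with off-diagonal entries `y s` (for `j ≤ s`) in row `p`. -/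
lemma exists_rowUnipotent {j : ℕ} {p : Fin d} (hp : p.val < j) (y : Fin d → F)
    (hy : ∀ s : Fin d, j ≤ s.val → y s ∈ 𝒪[F]) :
    ∃ k : GeneralLinearGroup (Fin d) 𝒪[F], ∀ r s,
      (GeneralLinearGroup.map (algebraMap 𝒪[F] F) k).val r s =
        (if r = s then 1 else 0) + if r = p ∧ j ≤ s.val then y s else 0 := by
  let y' : Fin d → 𝒪[F] := fun s => if h : j ≤ s.val then ⟨y s, hy s h⟩ else 0
  let U : Matrix (Fin d) (Fin d) 𝒪[F] := Matrix.of fun r s =>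
    (if r = s then 1 else 0) + if r = p ∧ j ≤ s.val then y' s else 0
  have hU : U.BlockTriangular id := fun r s (hrs : s < r) => by
    have h1 : ¬ (r = p ∧ j ≤ s.val) := by
      rintro ⟨rfl, h⟩
      have : s.val < r.val := hrs
      omega
    simp [U, hrs.ne', h1]
  have hdet : U.det = 1 := by
    rw [Matrix.det_of_isUpperTriangular hU]
    refine Finset.prod_eq_one fun r _ => ?_
    have h1 : ¬ (r = p ∧ j ≤ r.val) := by
      rintro ⟨rfl, h⟩
      omega
    simp [U, h1]
  refine ⟨GeneralLinearGroup.mk'' U (hdet ▸ isUnit_one), fun r s => ?_⟩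
  change ((U r s : 𝒪[F]) : F) = _
  simp only [U, y', Matrix.of_apply]
  split_ifs with h1 h2 h3 <;> simp_all

/-- Let `M` be the lattice of the new vertex, of colength one in the lattice `N` at time `t`, and
let `p` be the position about to increase. Not forming a cell with the first vertex means that the
basis vector of `N` at `p` is not in `M`, so it generates `N / M`. Correcting the basis vectors at
positions `≥ j` by multiples of it yields elements of `M`, and these corrections are the row of a
unipotent matrix. The hypothesis `hdom` makes this row integral. -/
lemma exists_of_mem_flow {j : ℕ} (hj : j < d) (hj1 : 1 ≤ j) (a : Fin d → ℤ) (t : ℤ)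
    (hdom : ∀ k i : Fin d, k.val < j → j ≤ i.val → a i ≤ stdExp j a t k) {τ : B1 ϖ d j}
    (hτ : τ ∈ flow ϖ d j (stdCell ϖ hj a t)) :
    ∃ k : GeneralLinearGroup (Fin d) 𝒪[F], intPGL k • stdCell ϖ hj a t = stdCell ϖ hj a t ∧
      τ = intPGL k • stdCell ϖ hj a (t + 1) := by
  have : NeZero d := ⟨by omega⟩
  obtain ⟨hshift, hnot⟩ := hτ
  obtain ⟨p, hp, hstep⟩ := stdExp_step a hj1 hj.le (t - j)
  set E : ℤ → Fin d → ℤ := stdExp j a with hE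
  have hEt : ∀ k : Fin d, E t k = E (t - j) k + if k.val < j then 1 else 0 := fun k => by
    rw [hE, ← stdExp_add_period, sub_add_cancel]
  have hEt1 : ∀ k : Fin d, E (t + 1) k = E (t - j + 1) k + if k.val < j then 1 else 0 :=
    fun k => by
      rw [hE, ← stdExp_add_period, show t - (j : ℤ) + 1 + j = t + 1 by ring]
  have hσ : ∀ i, (stdCell ϖ hj a t).1 i = vtx (dz ϖ (E (t - j + i.val))) := fun i => rfl
  obtain ⟨n, rfl⟩ : ∃ n, j = n + 1 := ⟨j - 1, by omega⟩
  have h0 : τ.1 0 = vtx (dz ϖ (E (t - (n + 1 : ℕ) + 1))) := by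
    have := hshift 0
    rw [hσ] at this
    simpa using this
  obtain ⟨g, hg, hv, hg0⟩ := τ.2.exists_chain_of_vtx hj 0 h0
  have hgord0 : gord (g 0) = ∑ k, E (t - (n + 1 : ℕ) + 1) k := by
    rw [gord_eq_of_lattice_eq hg0, gord_dz]
  have hglast : lattice (g (Fin.last n).castSucc) = lattice (dz ϖ (E t)) := by
    refine lattice_eq_of_vtx_eq ϖ ?_ ?_
    · rw [← hv, hshift, hσ]
      congr 3
      simp
    · rw [hg.gord_eq, hgord0, gord_dz, Fin.val_castSucc, Fin.val_last,
        ← sum_stdExp a hj1 hj.le (t - (n + 1 : ℕ) + 1) n,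
        show t - (n + 1 : ℕ) + 1 + (n : ℤ) = t by push_cast; ring]
  set M := g (Fin.last (n + 1)) with hM
  have hgM : gord M = gord (dz ϖ (E t)) + 1 := by
    rw [← gord_eq_of_lattice_eq hglast, hM, hg.gord_eq, hg.gord_eq (Fin.last n).castSucc]
    simp only [Fin.val_last, Fin.val_castSucc]
    push_cast
    ring
  have hMle : lattice M ≤ lattice (dz ϖ (E t)) := hglast ▸ hg.antitone (Fin.le_last _)
  have hwrap : lattice (dz ϖ fun i => 1 + E (t - (n + 1 : ℕ) + 1) i) ≤ lattice M := by
    rw [← sc_mul_dz]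
    exact (lattice_mul_eq_mul.2 hg0).ge.trans hg.wrap
  -- The exponent is `E t p`, so `f` is the basis vector of `N` at `p`. It is also `ϖ` times the
  -- basis vector at `p` of the first lattice of the cell.
  set f : Fin d → F := Pi.single p ((ϖ.unit ^ (E (t - (n + 1 : ℕ)) p + 1) : Fˣ) : F) with hf
  have hfN : f ∈ lattice (dz ϖ (E t)) :=
    single_mem_lattice_dz ϖ (by rw [hEt, if_pos hp])
  -- The first lattice differs from the second only at `p`. Were `f` in `M`, then `M` would contain
  -- `ϖ` times the first lattice, and the new vertex would close up to a cell with the old ones.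
  have hfM : f ∉ lattice M := by
    intro hfM
    have hw0 : lattice (sc ϖ d 1 * dz ϖ (E (t - (n + 1 : ℕ)))) ≤ lattice M := by
      rw [sc_mul_dz]
      refine lattice_le_of_col fun s => ?_
      rw [dz_col]
      rcases eq_or_ne s p with rfl | hs
      · rw [add_comm 1]; exact hfM
      · exact hwrap (single_mem_lattice_dz ϖ (by rw [hstep s, if_neg hs, add_zero]))
    apply hnot
    rcases Nat.lt_or_ge (n + 1 + 1) d with hjd | hjd
    · have hc : TypeOneChain ϖ (Fin.cons (dz ϖ (E (t - (n + 1 : ℕ)))) g) :=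
        hg.cons (by
          rw [hg0, lattice_dz_le_dz]
          exact fun k => stdExp_monotone a k (by omega)) (by
          rw [hgord0, gord_dz]
          exact_mod_cast sum_stdExp a hj1 hj.le (t - (n + 1 : ℕ)) 1) hw0
      refine ⟨n + 1 + 1, ?_⟩
      have h1 := (hc.isTypeOne hjd).1
      convert h1 using 1
      ext v
      simp only [Set.mem_insert_iff, Set.mem_range]
      constructor
      · rintro (rfl | ⟨i, rfl⟩)
        · exact ⟨(Fin.last _).succ, (hv _).symm⟩
        · induction i using Fin.cases with
          | zero => exact ⟨0, by rw [hσ]; simp⟩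
          | succ i => exact ⟨i.castSucc.succ, by rw [← hshift]; exact (hv _).symm⟩
      · rintro ⟨i, rfl⟩
        induction i using Fin.cases with
        | zero => exact .inr ⟨0, by rw [hσ]; simp⟩
        | succ i =>
          induction i using Fin.lastCases with
          | last => exact .inl (hv _).symm
          | cast i => exact .inr ⟨i.succ, by rw [← hshift]; exact hv _⟩
    -- Here `d = j + 1`, so there is no room for a larger cell: determinants force `M` to be `ϖ`
    -- times the first lattice, and the new vertex is the first vertex of the old cell.
    · have h1 : lattice (sc ϖ d 1 * dz ϖ (E (t - (n + 1 : ℕ)))) = lattice M := by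
        refine lattice_eq_of_le ϖ hw0 ?_
        have h2 := sum_stdExp a hj1 hj.le (t - (n + 1 : ℕ)) (n + 1)
        rw [sub_add_cancel] at h2
        rw [hgM, gord_mul, gord_sc, gord_dz, gord_dz]
        have h3 : (d : ℤ) = n + 2 := by omega
        rw [h3, ← hE] at *
        push_cast at h2 ⊢
        omega
      have h2 : τ.1 (Fin.last (n + 1)) = (stdCell ϖ hj a t).1 0 := by
        rw [hv, ← hM, ← vtx_eq_of_lattice_eq ϖ h1, vtx_sc_mul, hσ]
        simp
      rw [h2, Set.insert_eq_of_mem (Set.mem_range_self _)]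
      exact ⟨_, (stdCell ϖ hj a t).2.1⟩
  have hc : ∀ s : Fin d, ∃ c ∈ 𝒪[F], n + 1 ≤ s.val →
      Pi.single s ((ϖ.unit ^ a s : Fˣ) : F) - c • f ∈ lattice M := fun s => by
    by_cases hs : n + 1 ≤ s.val
    · obtain ⟨c, hc, hc'⟩ := exists_sub_smul_mem ϖ hMle hgM hfN hfM
        (single_mem_lattice_dz ϖ (s := s) (n := a s) (stdExp_of_le a t hs).le)
      exact ⟨c, hc, fun _ => hc'⟩
    · exact ⟨0, zero_mem _, fun h => absurd h hs⟩
  choose c hcO hcM using hc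
  -- The entry at `s` is chosen so that `k` takes `ϖ^(a s) e_s` to `ϖ^(a s) e_s - c_s f`. Its
  -- exponent is `E t p - a s`, nonnegative by `hdom`.
  obtain ⟨k, hk⟩ := exists_rowUnipotent (F := F) hp
    (fun s => -c s * ((ϖ.unit ^ (E (t - (n + 1 : ℕ)) p + 1 - a s) : Fˣ) : F)) fun s hs => by
      refine mul_mem (neg_mem (hcO s)) (unit_zpow_mem ϖ ?_)
      have h1 := hdom p s hp hs
      have h2 := hEt p
      rw [if_pos hp] at h2
      rw [hE] at *
      omega
  have hfix : ∀ i : Fin (n + 1 + 1), intPGL k • (stdCell ϖ hj a t).1 i = (stdCell ϖ hj a t).1 i := by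
    intro i
    rw [hσ]
    refine intPGL_smul_vtx_dz ϖ k _ ((lattice_mul_dz_le_dz ϖ _ _ _).2 fun r s => ?_)
    rw [hk]
    by_cases h1 : r = p ∧ n + 1 ≤ s.val
    · have hrs : r ≠ s := by
        rintro rfl
        rw [h1.1] at h1
        omega
      rw [if_pos h1, if_neg hrs, zero_add, mul_assoc, ← Units.val_mul, ← zpow_add, h1.1]
      refine mul_mem (neg_mem (hcO s)) (unit_zpow_mem ϖ ?_)
      have h2 : E (t - (n + 1 : ℕ) + i.val) s = a s := stdExp_of_le a _ h1.2
      have h3 : E (t - (n + 1 : ℕ) + i.val) p ≤ E t p := stdExp_monotone a p (by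
        have := i.2
        omega)
      rw [hEt, if_pos hp] at h3
      omega
    · rw [if_neg h1, add_zero]
      split_ifs with h2
      · rw [h2, sub_self, zpow_zero, Units.val_one, one_mul]
        exact one_mem _
      · rw [zero_mul]
        exact zero_mem _
  have hlast : lattice (GeneralLinearGroup.map (algebraMap 𝒪[F] F) k * dz ϖ (E (t + 1))) =
      lattice M := by
    refine lattice_eq_of_le ϖ (lattice_le_of_col fun s => ?_) ?_
    · have hcol : (fun i => (GeneralLinearGroup.map (algebraMap 𝒪[F] F) k *
          dz ϖ (E (t + 1))).val i s) = fun i =>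
          (GeneralLinearGroup.map (algebraMap 𝒪[F] F) k).val i s *
            ((ϖ.unit ^ E (t + 1) s : Fˣ) : F) := by
        ext i
        rw [Units.val_mul, dz_val, Matrix.mul_diagonal]
      rw [hcol]
      simp only [hk]
      by_cases hs : n + 1 ≤ s.val
      · convert hcM s hs using 1
        ext i
        have hes : E (t + 1) s = a s := stdExp_of_le a _ hs
        simp only [hs, and_true, hes, hf, Pi.sub_apply, Pi.smul_apply, smul_eq_mul, Pi.single_apply]
        have h2 : ((ϖ.unit ^ (E (t - (n + 1 : ℕ)) p + 1 - a s) : Fˣ) : F) *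
            ((ϖ.unit ^ a s : Fˣ) : F) = ((ϖ.unit ^ (E (t - (n + 1 : ℕ)) p + 1) : Fˣ) : F) := by
          rw [← Units.val_mul, ← zpow_add, sub_add_cancel]
        rw [add_mul]
        split_ifs
        · rw [mul_assoc, h2]; ring
        · ring
        · rw [mul_assoc, h2]; ring
        · ring
      · have h1 : (fun i => ((if i = s then (1 : F) else 0) + if i = p ∧ n + 1 ≤ s.val then
            -c s * ((ϖ.unit ^ (E (t - (n + 1 : ℕ)) p + 1 - a s) : Fˣ) : F) else 0) *
            ((ϖ.unit ^ E (t + 1) s : Fˣ) : F)) =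
            Pi.single s ((ϖ.unit ^ E (t + 1) s : Fˣ) : F) := by
          ext i
          simp [hs, Pi.single_apply]
        rw [h1]
        -- A column at a position `< j` is unchanged by `k`, and it lies in `ϖ` times the second
        -- lattice of the old cell.
        refine hwrap (single_mem_lattice_dz ϖ ?_)
        rw [hEt1, if_pos (by omega)]
        omega
    · rw [gord_mul, gord_map, zero_add, hgM, gord_dz, gord_dz]
      exact_mod_cast sum_stdExp a hj1 hj.le t 1
  refine ⟨k, Subtype.ext (funext hfix), Subtype.ext (funext fun i => ?_)⟩
  change τ.1 i = intPGL k • (stdCell ϖ hj a (t + 1)).1 i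
  induction i using Fin.lastCases with
  | last =>
    rw [hv, ← hM, ← vtx_eq_of_lattice_eq ϖ hlast, vtx_mul]
    simp only [stdCell, stdChain, Fin.val_last]
    rw [show t + 1 - ((n + 1 : ℕ) : ℤ) + ((n + 1 : ℕ) : ℤ) = t + 1 by ring]
    rfl
  | cast i => rw [hshift, (stdCell_mem_flow ϖ hj hj1 a t).1 i, hfix]

/-! ### Raising the dimension of standard cells -/

lemma stdExp_raise {j : ℕ} (a : Fin d → ℤ) (i : Fin (j + 1)) :
    stdExp (j + 1) a (0 - (j + 1 : ℕ) + (i.succ.val : ℤ)) = stdExp j a (0 - j + i.val) := by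
  have hi := i.2
  funext k
  rw [show (0 - ((j + 1 : ℕ) : ℤ) + (i.succ.val : ℤ)) = -((j - i.val : ℕ) : ℤ) by
      rw [Fin.val_succ]; omega,
    show (0 - (j : ℤ) + (i.val : ℤ)) = -((j - i.val : ℕ) : ℤ) by omega,
    stdExp_neg a (by omega), stdExp_neg a (by omega)]

lemma stdChain_raise {j : ℕ} (a : Fin d → ℤ) (i : Fin (j + 1)) :
    stdChain ϖ (j + 1) a 0 i.succ = stdChain ϖ j a 0 i := by
  rw [stdChain, stdChain, stdExp_raise]

lemma stdCell_mem_raise {j : ℕ} (hj : j + 1 < d) (a : Fin d → ℤ) :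
    stdCell ϖ hj a 0 ∈ raise ϖ d j (stdCell ϖ (by omega) a 0) := by
  refine ⟨(stdCell ϖ hj a 0).1 0, funext fun i => ?_⟩
  induction i using Fin.cases with
  | zero => rfl
  | succ i =>
    rw [Fin.cons_succ]
    simp only [stdCell, stdChain_raise]

/-- A primitive vector supported at the positions `≥ j` is the column at position `j` of a matrix in
`GL_d(𝒪)` which is the identity outside the positions `≥ j`. -/
lemma exists_col_eq {j q : Fin d} (hjq : j ≤ q) {b : Fin d → F} (hb : ∀ i, b i ∈ 𝒪[F])
    (hb0 : ∀ i, i < j → b i = 0) (hq0 : b q ≠ 0) (hq : (b q)⁻¹ ∈ 𝒪[F]) :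
    ∃ k : GeneralLinearGroup (Fin d) 𝒪[F],
      (∀ r, (GeneralLinearGroup.map (algebraMap 𝒪[F] F) k).val r j = b r) ∧
      ∀ r s, (r < j ∨ s < j) → r ≠ s →
        (GeneralLinearGroup.map (algebraMap 𝒪[F] F) k).val r s = 0 := by
  let b' : Fin d → 𝒪[F] := fun i => ⟨b i, hb i⟩
  let A : Matrix (Fin d) (Fin d) 𝒪[F] := (1 : Matrix (Fin d) (Fin d) 𝒪[F]).updateCol q b'
  let U : Matrix (Fin d) (Fin d) 𝒪[F] := A.submatrix id (Equiv.swap j q)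
  have hA : A.det = b' q := by
    rw [← Matrix.cramer_apply, Matrix.cramer_one]
    rfl
  have hu : IsUnit (b' q) := IsUnit.of_mul_eq_one ⟨_, hq⟩ (Subtype.ext (mul_inv_cancel₀ hq0))
  have hU : IsUnit U.det := by
    rw [Matrix.det_permute', hA]
    exact (Units.isUnit
      ((Units.map (Int.castRingHom 𝒪[F] : ℤ →* 𝒪[F])) (Equiv.Perm.sign (Equiv.swap j q)))).mul hu
  refine ⟨GeneralLinearGroup.mk'' U hU, fun r => ?_, fun r s hrs hne => ?_⟩
  · change ((U r j : 𝒪[F]) : F) = _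
    simp [U, A, b']
  · change ((U r s : 𝒪[F]) : F) = 0
    simp only [U, A, Matrix.submatrix_apply, id_eq, Matrix.updateCol_apply]
    split_ifs with h
    · rcases hrs with hr | hs
      · exact hb0 r hr
      · rw [Equiv.swap_apply_of_ne_of_ne hs.ne (hs.trans_le hjq).ne] at h
        exact absurd h (hs.trans_le hjq).ne
    · rw [Matrix.one_apply_ne, ZeroMemClass.coe_zero]
      rintro rfl
      rcases hrs with hr | hs
      · rw [← Equiv.swap_apply_of_ne_of_ne hr.ne (hr.trans_le hjq).ne] at hne
        apply hne
        rw [Equiv.swap_apply_self]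
      · exact hne (Equiv.swap_apply_of_ne_of_ne hs.ne (hs.trans_le hjq).ne)

/-- Let `f` lie in the lattice of the new first vertex but not in that of the old one. Only its
coordinates at positions `≥ j` matter, and after scaling they form a primitive vector. A matrix of
`GL_d(𝒪)` acting on these positions alone carries the `j`-th basis vector to it, and fixes the old
cell because the exponents there are all equal to `c`. -/
lemma exists_of_mem_raise {j : ℕ} (hj : j + 1 < d) (a : Fin d → ℤ) (c : ℤ)
    (hc : ∀ i : Fin d, j ≤ i.val → a i = c) {τ : B1 ϖ d (j + 1)}
    (hτ : τ ∈ raise ϖ d j (stdCell ϖ (by omega) a 0)) :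
    ∃ k : GeneralLinearGroup (Fin d) 𝒪[F],
      intPGL k • stdCell ϖ (show j < d by omega) a 0 = stdCell ϖ (by omega) a 0 ∧
      τ = intPGL k • stdCell ϖ hj a 0 := by
  have : NeZero d := ⟨by omega⟩
  obtain ⟨v, hτv⟩ := hτ
  have hsucc : ∀ i : Fin (j + 1), τ.1 i.succ = vtx (stdChain ϖ j a 0 i) := fun i => by
    rw [hτv, Fin.cons_succ]
    rfl
  have hchain := stdChain_typeOneChain ϖ (show j < d by omega) a 0
  obtain ⟨g, hg, hv, hg1⟩ := τ.2.exists_chain_of_vtx hj (Fin.succ 0) (hsucc 0)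
  have hN0 : lattice (stdChain ϖ j a 0 0) ≤ lattice (g 0) := hg1 ▸ hg.antitone (Fin.zero_le _)
  have hgM : gord (stdChain ϖ j a 0 0) = gord (g 0) + 1 := by
    rw [← gord_eq_of_lattice_eq hg1, hg.gord_eq]
    simp
  have hlast : lattice (g (Fin.last (j + 1))) = lattice (stdChain ϖ j a 0 (Fin.last j)) := by
    rw [← Fin.succ_last]
    refine lattice_eq_of_vtx_eq ϖ ((hv _).symm.trans (hsucc _)) ?_
    rw [hg.gord_eq, hchain.gord_eq, hgM]
    simp only [Fin.succ_last, Fin.val_last]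
    push_cast
    ring
  have hexp0 : ∀ i, stdExp j a (0 - j + ((0 : Fin (j + 1)).val : ℤ)) i =
      a i - if i.val < j then 1 else 0 := fun i => by
    rw [← stdExp_neg a le_rfl]
    congr 1
    simp
  have hexpj : ∀ i, stdExp j a (0 - j + ((Fin.last j).val : ℤ)) i = a i := fun i => by
    have := stdExp_neg (j := j) a (Nat.zero_le j) i
    simpa using this
  obtain ⟨f, hfM, hfN⟩ := SetLike.not_le_iff_exists.1 fun h : lattice (g 0) ≤ _ => by
    have := gord_eq_of_lattice_eq (le_antisymm h hN0)
    omega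
  -- `ϖ f` lies in the last lattice of the cell, which has exponents `a`.
  have hwrap : ∀ i, ((ϖ.unit ^ (1 - a i) : Fˣ) : F) * f i ∈ 𝒪[F] := by
    have h1 : ϖ.val • f ∈ lattice (dz ϖ (stdExp j a (0 - j + ((Fin.last j).val : ℤ)))) :=
      hlast.le (hg.wrap (by
        rw [← smul_lattice]
        exact Submodule.smul_mem_pointwise_smul _ _ _ hfM))
    rw [mem_lattice_dz] at h1
    intro i
    have h2 := h1 i
    rw [hexpj] at h2
    rw [show 1 - a i = -a i + 1 by ring, zpow_add, zpow_one, Units.val_mul, mul_assoc]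
    exact h2
  obtain ⟨q, hq⟩ : ∃ q, ((ϖ.unit ^ (-(a q - if q.val < j then 1 else 0)) : Fˣ) : F) * f q ∉ 𝒪[F] := by
    by_contra! H
    refine hfN ((mem_lattice_dz ϖ _ _).2 fun i => ?_)
    rw [hexp0]
    exact H i
  -- At positions `< j` the old first lattice has exponents `a - 1`, so there `hwrap` already gives
  -- membership.
  have hjq : j ≤ q.val := by
    by_contra! hqj
    rw [if_pos hqj, show -(a q - 1) = 1 - a q by ring] at hq
    exact hq (hwrap q)
  rw [if_neg (by omega), sub_zero] at hq
  let J : Fin d := ⟨j, by omega⟩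
  -- `b q` is integral, but not divisible by `ϖ` by the choice of `q`; hence it is a unit and `b` is
  -- primitive.
  let b : Fin d → F := fun i => if j ≤ i.val then ((ϖ.unit ^ (1 - a i) : Fˣ) : F) * f i else 0
  have hbq : b q = ((ϖ.unit ^ (1 - a q) : Fˣ) : F) * f q := if_pos hjq
  have hfq0 : f q ≠ 0 := fun h => hq (by rw [h, mul_zero]; exact zero_mem _)
  have hbq0 : b q ≠ 0 := by
    rw [hbq]
    exact mul_ne_zero (Units.ne_zero _) hfq0
  obtain ⟨k, hkJ, hk0⟩ := exists_col_eq (F := F) (j := J) (q := q) hjq (b := b)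
    (fun i => by
      simp only [b]
      split_ifs
      · exact hwrap i
      · exact zero_mem _)
    (fun i hi => if_neg (by have : i.val < j := hi; omega)) hbq0
    ((inv_mem_or_mem ϖ hbq0).resolve_right (by
      rwa [hbq, ← mul_assoc, ← Units.val_mul, ← zpow_add,
        show -1 + (1 - a q) = -a q by ring]))
  have hstab : ∀ e : Fin d → ℤ, (∀ i : Fin d, j ≤ i.val → e i = c) →
      lattice (GeneralLinearGroup.map (algebraMap 𝒪[F] F) k * dz ϖ e) ≤ lattice (dz ϖ e) := by
    intro e he
    rw [lattice_mul_dz_le_dz]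
    intro r s
    rcases eq_or_ne r s with rfl | hrs
    · rw [sub_self, zpow_zero, Units.val_one, mul_one]
      exact map_integral k r r
    · by_cases h : r < J ∨ s < J
      · rw [hk0 r s h hrs, zero_mul]
        exact zero_mem _
      · push Not at h
        rw [he r h.1, he s h.2, sub_self, zpow_zero, Units.val_one, mul_one]
        exact map_integral k r s
  have hfix : ∀ i : Fin (j + 1), intPGL k • vtx (stdChain ϖ j a 0 i) = vtx (stdChain ϖ j a 0 i) :=
    fun i => intPGL_smul_vtx_dz ϖ k _ (hstab _ fun r hr => by rw [stdExp_of_le a _ hr, hc r hr])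
  have hexp' : ∀ i, stdExp (j + 1) a (0 - (j + 1 : ℕ) + ((0 : Fin (j + 1 + 1)).val : ℤ)) i =
      a i - if i.val < j + 1 then 1 else 0 := fun i => by
    rw [← stdExp_neg a le_rfl]
    congr 1
  have hM : lattice (GeneralLinearGroup.map (algebraMap 𝒪[F] F) k * stdChain ϖ (j + 1) a 0 0) =
      lattice (g 0) := by
    refine lattice_eq_of_le ϖ (lattice_le_of_col fun s => ?_) ?_
    · rcases eq_or_ne s J with rfl | hs
      -- Column `j` of the product is `f` with its coordinates below `j` removed; the removed part
      -- lies in the old first lattice by `hwrap`. The other columns are those of `k` applied to the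
      -- old lattice.
      · have h1 : (fun i => (GeneralLinearGroup.map (algebraMap 𝒪[F] F) k *
            stdChain ϖ (j + 1) a 0 0).val i J) = f - fun i => if j ≤ i.val then 0 else f i := by
          ext i
          rw [stdChain, Units.val_mul, dz_val, Matrix.mul_diagonal, hkJ, hexp']
          simp only [b, J, Pi.sub_apply]
          split_ifs with h1 h2
          · rw [hc i h1, hc _ le_rfl, mul_right_comm, ← Units.val_mul, ← zpow_add,
              show 1 - c + (c - 1) = 0 by ring, zpow_zero, Units.val_one, one_mul, sub_zero]
          · omega
          · rw [zero_mul, sub_self]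
          · rw [zero_mul, sub_self]
        rw [h1]
        refine (lattice (g 0)).sub_mem hfM (hN0 ((mem_lattice_dz ϖ _ _).2 fun i => ?_))
        rw [hexp0]
        split_ifs with h2 h3
        · omega
        · rw [show -(a i - 1) = 1 - a i by ring]; exact hwrap i
        · rw [mul_zero]; exact zero_mem _
        · omega
      · have h1 : (fun i => (GeneralLinearGroup.map (algebraMap 𝒪[F] F) k *
            stdChain ϖ (j + 1) a 0 0).val i s) =
            fun i => (GeneralLinearGroup.map (algebraMap 𝒪[F] F) k *
            stdChain ϖ j a 0 0).val i s := by
          ext i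
          rw [stdChain, stdChain, Units.val_mul, Units.val_mul, dz_val, dz_val,
            Matrix.mul_diagonal, Matrix.mul_diagonal, hexp', hexp0]
          have : s.val ≠ j := fun h => hs (Fin.ext h)
          have h2 : (s.val < j + 1) = (s.val < j) := by
            apply propext
            omega
          simp only [h2]
        rw [h1]
        exact hN0 (hstab _ (fun r hr => by rw [stdExp_of_le a _ hr, hc r hr])
          (col_mem_lattice _ s))
    · rw [gord_mul, gord_map, zero_add]
      have h1 := (stdChain_typeOneChain ϖ hj a 0).gord_eq (Fin.succ 0)
      rw [stdChain_raise, hgM] at h1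
      simp only [Fin.val_succ, Fin.val_zero] at h1
      omega
  refine ⟨k, Subtype.ext (funext hfix), Subtype.ext (funext fun i => ?_)⟩
  change τ.1 i = intPGL k • vtx (stdChain ϖ (j + 1) a 0 i)
  induction i using Fin.cases with
  | zero => rw [hv, ← vtx_eq_of_lattice_eq ϖ hM, vtx_mul, intPGL]
  | succ i => rw [hsucc, stdChain_raise, hfix]

end LocalField

/-! ### Equivariant branching operators -/

/-- A branching operator that commutes with the group action. -/
def Branching.Equivariant (G : Type*) {Ω₁ Ω₂ : Type*} [Group G] [MulAction G Ω₁] [MulAction G Ω₂]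
    (T : Branching Ω₁ Ω₂) : Prop :=
  ∀ (g : G) (s : Ω₁) (t : Ω₂), t ∈ T s → g • t ∈ T (g • s)

/-- By equivariance and transitivity on `Ω₁` it suffices to compare values at `a`, and there the
branches are the orbit of `g • b` under the stabilizer of `a`. -/
lemma Branching.Equivariant.eq_hecke {G Ω₁ Ω₂ : Type*} [Group G] [MulAction G Ω₁] [MulAction G Ω₂]
    {T : Branching Ω₁ Ω₂} (hT : T.Equivariant G) {a : Ω₁} {g : G} {b : Ω₂}
    (horb : MulAction.orbit G a = Set.univ) (hmem : g • b ∈ T a)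
    (htrans : ∀ t ∈ T a, ∃ p : G, p • a = a ∧ t = p • g • b) : T = hecke a g b := by
  funext s
  obtain ⟨h, rfl⟩ : s ∈ MulAction.orbit G a := horb ▸ Set.mem_univ s
  ext t
  constructor
  · intro ht
    have h1 := hT h⁻¹ _ _ ht
    simp only [inv_smul_smul] at h1
    obtain ⟨p, hp, hpt⟩ := htrans _ h1
    refine ⟨h, rfl, p, hp, ?_⟩
    rw [mul_smul, mul_smul, ← hpt, smul_inv_smul]
  · rintro ⟨g', hg', p, hp, rfl⟩
    change h • a = g' • a at hg'
    have h1 := hT (g' * p) _ _ hmem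
    rw [mul_smul g' p a, show p • a = a from hp, ← hg', ← mul_smul] at h1
    exact h1

section LocalField

set_option linter.unusedSectionVars false

variable {F : Type*} [Field F] [ValuativeRel F] [TopologicalSpace F] [IsNonarchimedeanLocalField F]
variable {d : ℕ} (ϖ : Uniformizer F)

variable (F d) in
/-- The `K`-orbit of `s`. -/
def kOrbit {Ω : Type*} [MulAction (PGL F d) Ω] (s : Ω) : Set Ω :=
  Set.range fun k : GeneralLinearGroup (Fin d) 𝒪[F] => intPGL k • s

lemma intPGL_one : intPGL (1 : GeneralLinearGroup (Fin d) 𝒪[F]) = 1 := by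
  unfold intPGL
  rw [map_one]
  rfl

lemma intPGL_mul (k k' : GeneralLinearGroup (Fin d) 𝒪[F]) :
    intPGL (k * k') = intPGL k * intPGL k' := by
  unfold intPGL
  rw [map_mul]
  rfl

variable (F d) in
/-- The branches at `s` are the translates of `t` under the stabilizer of `s` in `K`. -/
def BranchesTransitively {Ω₁ Ω₂ : Type*} [MulAction (PGL F d) Ω₁] [MulAction (PGL F d) Ω₂]
    (T : Branching Ω₁ Ω₂) (s : Ω₁) (t : Ω₂) : Prop :=
  t ∈ T s ∧ ∀ t' ∈ T s, ∃ k : GeneralLinearGroup (Fin d) 𝒪[F],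
    intPGL k • s = s ∧ t' = intPGL k • t

lemma BranchesTransitively.biUnion_kOrbit {Ω₁ Ω₂ : Type*} [MulAction (PGL F d) Ω₁]
    [MulAction (PGL F d) Ω₂] {T : Branching Ω₁ Ω₂} (hT : T.Equivariant (PGL F d)) {s : Ω₁} {t : Ω₂}
    (h : BranchesTransitively F d T s t) : ⋃ b ∈ kOrbit F d s, T b = kOrbit F d t := by
  ext t'
  simp only [Set.mem_iUnion, exists_prop, kOrbit, Set.mem_range, exists_exists_eq_and]
  constructor
  · rintro ⟨k, hk⟩
    have h1 := hT (intPGL k)⁻¹ _ _ hk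
    rw [inv_smul_smul] at h1
    obtain ⟨k', -, hk'⟩ := h.2 _ h1
    exact ⟨k * k', by rw [intPGL_mul, mul_smul, ← hk', smul_inv_smul]⟩
  · rintro ⟨k, rfl⟩
    exact ⟨k, hT _ _ _ h.1⟩

lemma BranchesTransitively.eq_hecke {Ω₁ Ω₂ : Type*} [MulAction (PGL F d) Ω₁]
    [MulAction (PGL F d) Ω₂] {T : Branching Ω₁ Ω₂} (hT : T.Equivariant (PGL F d)) {s : Ω₁} {t : Ω₂}
    {g : PGL F d} (h : BranchesTransitively F d T s (g • t))
    (horb : MulAction.orbit (PGL F d) s = Set.univ) : T = hecke s g t :=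
  hT.eq_hecke horb h.1 fun t' ht' => by
    obtain ⟨k, hk⟩ := h.2 t' ht'
    exact ⟨_, hk⟩

lemma biUnion_comp {Ω₁ Ω₂ Ω₃ : Type*} (T : Branching Ω₂ Ω₃) (S : Branching Ω₁ Ω₂) (A : Set Ω₁) :
    ⋃ a ∈ A, T.comp S a = ⋃ b ∈ ⋃ a ∈ A, S a, T b := by
  simp only [Branching.comp, Set.biUnion_iUnion]

lemma IsCell.smul {ϖ : Uniformizer F} {s : Set (Vertex F d)} (hs : IsCell ϖ s) (g : PGL F d) :
    IsCell ϖ ((fun v => g • v) '' s) := by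
  obtain ⟨r, hr⟩ := hs
  exact ⟨r, hr.smul ϖ g⟩

lemma flow_equivariant (j : ℕ) : (flow ϖ d j).Equivariant (PGL F d) := by
  rintro g σ τ ⟨h1, h2⟩
  refine ⟨fun i => ?_, fun h3 => h2 ?_⟩
  · change g • τ.1 _ = g • σ.1 _
    rw [h1]
  · have h4 := h3.smul g⁻¹
    rw [Set.image_insert_eq, ← Set.range_comp] at h4
    change IsCell ϖ (insert (g⁻¹ • g • τ.1 (Fin.last j)) (Set.range fun i => g⁻¹ • g • σ.1 i)) at h4
    simpa only [inv_smul_smul] using h4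

lemma raise_equivariant (j : ℕ) : (raise ϖ d j).Equivariant (PGL F d) := by
  rintro g σ τ ⟨v, hv⟩
  refine ⟨g • v, funext fun i => ?_⟩
  change g • τ.1 i = _
  rw [hv]
  induction i using Fin.cases with
  | zero => rfl
  | succ i => rfl

lemma lastVertex_equivariant (j : ℕ) : (lastVertex ϖ d j).Equivariant (PGL F d) := by
  rintro g σ _ rfl
  rfl

lemma flow_branchesTransitively {j : ℕ} (hj : j < d) (hj1 : 1 ≤ j) (a : Fin d → ℤ) (t : ℤ)
    (hdom : ∀ k i : Fin d, k.val < j → j ≤ i.val → a i ≤ stdExp j a t k) :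
    BranchesTransitively F d (flow ϖ d j) (stdCell ϖ hj a t) (stdCell ϖ hj a (t + 1)) :=
  ⟨stdCell_mem_flow ϖ hj hj1 a t, fun _ h => exists_of_mem_flow ϖ hj hj1 a t hdom h⟩

lemma raise_branchesTransitively {j : ℕ} (hj : j + 1 < d) (a : Fin d → ℤ) (c : ℤ)
    (hc : ∀ i : Fin d, j ≤ i.val → a i = c) :
    BranchesTransitively F d (raise ϖ d j) (stdCell ϖ (show j < d by omega) a 0)
      (stdCell ϖ hj a 0) :=
  ⟨stdCell_mem_raise ϖ hj a, fun _ h => exists_of_mem_raise ϖ hj a c hc h⟩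

lemma lastVertex_branchesTransitively {j : ℕ} (σ : B1 ϖ d j) :
    BranchesTransitively F d (lastVertex ϖ d j) σ (σ.1 (Fin.last j)) :=
  ⟨rfl, fun _ h => ⟨1, by rw [intPGL_one, one_smul], by rw [intPGL_one, one_smul]; exact h⟩⟩

/-! ### The base cells -/

lemma xiMat_eq_dz (i : ℕ) :
    xiMat ϖ d i = dz ϖ fun k => (1 : ℤ) - if k.val < i then 1 else 0 := by
  unfold xiMat dz
  congr 1
  funext k
  by_cases h : k.val < i <;> simp [h]

lemma stdExp_zero (j : ℕ) (a : Fin d → ℤ) : stdExp j a 0 = a := by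
  funext k
  have := stdExp_neg (j := j) a (Nat.zero_le j) k
  simpa using this

lemma baseCell_eq_stdCell {j : ℕ} (hj : j < d) :
    baseCell ϖ d j hj = stdCell ϖ hj (fun _ => 1) 0 := by
  refine Subtype.ext (funext fun i => ?_)
  change vtx (xiMat ϖ d (j - i.val)) = vtx (dz ϖ _)
  rw [xiMat_eq_dz]
  congr 2
  have hi := i.2
  rw [show (0 - (j : ℤ) + (i.val : ℤ)) = -((j - i.val : ℕ) : ℤ) by omega]
  funext k
  rw [stdExp_neg _ (by omega)]

lemma vtx_dz_const (n : ℤ) : vtx (dz ϖ fun _ : Fin d => n) = xi F d := by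
  change toPGL (sc ϖ d n) • xi F d = xi F d
  rw [toPGL_sc, one_smul]

/-- Induction on `j`: deleting the first vertex leaves a cell in the orbit of the smaller base cell,
and all extensions of that base cell are conjugate under its stabilizer. -/
lemma orbit_baseCell {j : ℕ} (hj : j < d) :
    MulAction.orbit (PGL F d) (baseCell ϖ d j hj) = Set.univ := by
  rw [Set.eq_univ_iff_forall]
  induction j with
  | zero =>
    intro σ
    obtain ⟨g, hg⟩ := exists_vtx_eq (σ.1 0)
    refine ⟨toPGL g, Subtype.ext (funext fun i => ?_)⟩
    rw [baseCell_eq_stdCell]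
    change toPGL g • vtx (dz ϖ _) = σ.1 i
    have hi : i = 0 := Subsingleton.elim (α := Fin 1) _ _
    subst hi
    have h0 : stdExp 0 (fun _ : Fin d => 1) (0 - ((0 : ℕ) : ℤ) + ((0 : Fin 1).val : ℤ)) =
        fun _ => 1 := by
      funext k
      simp [stdExp]
    rw [h0, vtx_dz_const, hg]
    rfl
  | succ j ih =>
    intro σ
    obtain ⟨g, hg, hv⟩ := σ.2.exists_chain hj
    let σ' : B1 ϖ d j := ⟨fun i => vtx (g i.succ), hg.tail.isTypeOne (by omega)⟩
    have hσ : σ ∈ raise ϖ d j σ' := ⟨σ.1 0, funext fun i => by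
      induction i using Fin.cases with
      | zero => rfl
      | succ i =>
        rw [Fin.cons_succ]
        exact hv _⟩
    obtain ⟨h, hh⟩ := ih (by omega) σ'
    change h • baseCell ϖ d j (by omega) = σ' at hh
    rw [← hh] at hσ
    have h1 := raise_equivariant ϖ j h⁻¹ _ _ hσ
    rw [inv_smul_smul, baseCell_eq_stdCell] at h1
    obtain ⟨k, -, hk⟩ := exists_of_mem_raise ϖ hj (fun _ => 1) 1 (fun _ _ => rfl) h1
    refine ⟨h * intPGL k, ?_⟩
    change (h * intPGL k) • baseCell ϖ d (j + 1) hj = σ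
    rw [baseCell_eq_stdCell, mul_smul, ← hk, smul_inv_smul]

/-- The matrix `w_j` shifts the standard geodesic of period `j` with constant initial exponents. -/
lemma lattice_wMat_mul_dz {j : ℕ} (hj : j < d) (hj1 : 1 ≤ j) (t : ℤ) :
    lattice (GeneralLinearGroup.mkOfDetNeZero (wMat ϖ d j) (det_wMat_ne_zero ϖ d j hj) *
      dz ϖ (stdExp j (fun _ => 1) t)) = lattice (dz ϖ (stdExp j (fun _ => 1) (t + 1))) := by
  set W := GeneralLinearGroup.mkOfDetNeZero (wMat ϖ d j) (det_wMat_ne_zero ϖ d j hj) with hW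
  have hWv : W.val = wMat ϖ d j := rfl
  set E := stdExp (d := d) j (fun _ => 1) with hE
  have e1 : ∀ r s : Fin d, r.val + 1 < j → s.val = r.val + 1 → E (t + 1) r = E t s := by
    intro r s hr hs
    simp only [hE, stdExp]
    rw [if_pos (by omega), if_pos (by omega), hs]
    push_cast
    congr 2
    ring
  have e2 : ∀ r s : Fin d, r.val + 1 = j → s.val = 0 → E (t + 1) r = E t s + 1 := by
    intro r s hr hs
    simp only [hE, stdExp]
    rw [if_pos (by omega), if_pos (by omega), hs]
    rw [show t + 1 + (r.val : ℤ) = t + j by omega, Int.add_ediv_of_dvd_right (dvd_refl _),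
      Int.ediv_self (by omega)]
    push_cast
    ring_nf
  have e3 : ∀ r : Fin d, j ≤ r.val → E (t + 1) r = E t r := fun r hr => by
    rw [hE, stdExp_of_le _ _ hr, stdExp_of_le _ _ hr]
  refine le_antisymm ((lattice_mul_dz_le_dz ϖ _ _ _).2 fun r s => ?_)
    (lattice_le_of_col fun r => ?_)
  · rw [hWv]
    simp only [wMat, Matrix.of_apply]
    split_ifs with h1 h2 h3 h4 h5
    · rw [e1 r s h1 h2, sub_self, zpow_zero, Units.val_one, one_mul]
      exact one_mem _
    · rw [zero_mul]; exact zero_mem _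
    · rw [e2 r s h3 h4, ← zpow_one ϖ.unit, ← zpow_mul, ← Units.val_mul, ← zpow_add]
      exact unit_zpow_mem ϖ (by omega)
    · rw [zero_mul]; exact zero_mem _
    · subst h5
      rw [e3 s (by omega), sub_self, zpow_zero, Units.val_one, one_mul]
      exact one_mem _
    · rw [zero_mul]; exact zero_mem _
  · obtain ⟨s, hs⟩ : ∃ s : Fin d, (fun i => (W * dz ϖ (E t)).val i s) =
        Pi.single r ((ϖ.unit ^ E (t + 1) r : Fˣ) : F) := by
      have hcol : ∀ s i, (W * dz ϖ (E t)).val i s =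
          wMat ϖ d j i s * ((ϖ.unit ^ E t s : Fˣ) : F) := fun s i => by
        rw [Units.val_mul, dz_val, Matrix.mul_diagonal, hWv]
      rcases lt_trichotomy (r.val + 1) j with h | h | h
      · refine ⟨⟨r + 1, by omega⟩, funext fun i => ?_⟩
        rw [hcol, e1 r ⟨r + 1, by omega⟩ h rfl]
        simp only [wMat, Matrix.of_apply, Pi.single_apply, Fin.ext_iff]
        split_ifs <;> first | omega | contradiction | simp
      · refine ⟨⟨0, by omega⟩, funext fun i => ?_⟩
        rw [hcol, e2 r ⟨0, by omega⟩ h rfl, zpow_add, zpow_one, Units.val_mul]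
        simp only [wMat, Matrix.of_apply, Pi.single_apply, Fin.ext_iff]
        split_ifs <;> first | omega | contradiction | simp [mul_comm]
      · refine ⟨r, funext fun i => ?_⟩
        rw [hcol, e3 r (by omega)]
        simp only [wMat, Matrix.of_apply, Pi.single_apply, Fin.ext_iff]
        split_ifs <;> first | omega | contradiction | simp
    rw [dz_col, ← hs]
    exact col_mem_lattice _ s

lemma w_smul_baseCell {j : ℕ} (hj : j < d) (hj1 : 1 ≤ j) :
    w ϖ d j hj • baseCell ϖ d j hj = stdCell ϖ hj (fun _ => 1) (0 + 1) := by
  rw [baseCell_eq_stdCell]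
  refine Subtype.ext (funext fun i => ?_)
  change w ϖ d j hj • vtx (dz ϖ (stdExp j (fun _ : Fin d => 1) (0 - j + i.val))) =
    vtx (dz ϖ (stdExp j (fun _ : Fin d => 1) (0 + 1 - j + i.val)))
  rw [w, ← vtx_mul, show (0 + 1 - (j : ℤ) + (i.val : ℤ)) = 0 - j + i.val + 1 by ring]
  exact vtx_eq_of_lattice_eq ϖ (lattice_wMat_mul_dz ϖ hj hj1 _)

lemma flow_eq_hecke {j : ℕ} (hj : j < d) (hj1 : 1 ≤ j) :
    flow ϖ d j = hecke (baseCell ϖ d j hj) (w ϖ d j hj) (baseCell ϖ d j hj) := by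
  refine BranchesTransitively.eq_hecke (flow_equivariant ϖ j) ?_ (orbit_baseCell ϖ hj)
  rw [w_smul_baseCell ϖ hj hj1, baseCell_eq_stdCell]
  refine flow_branchesTransitively ϖ hj hj1 _ _ fun k i _ _ => ?_
  rw [stdExp_zero]

lemma raise_eq_hecke {j : ℕ} (hj : j + 1 < d) :
    raise ϖ d j = hecke (baseCell ϖ d j (by omega)) (1 : PGL F d) (baseCell ϖ d (j + 1) hj) := by
  refine BranchesTransitively.eq_hecke (raise_equivariant ϖ j) ?_ (orbit_baseCell ϖ _)
  rw [one_smul, baseCell_eq_stdCell, baseCell_eq_stdCell]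
  exact raise_branchesTransitively ϖ hj _ 1 fun _ _ => rfl

lemma lastVertex_eq_hecke {j : ℕ} (hj : j < d) :
    lastVertex ϖ d j = hecke (baseCell ϖ d j hj) (1 : PGL F d) (xi F d) := by
  refine BranchesTransitively.eq_hecke (lastVertex_equivariant ϖ j) ?_ (orbit_baseCell ϖ _)
  have h : (baseCell ϖ d j hj).1 (Fin.last j) = xi F d := by
    change vtx (xiMat ϖ d (j - (Fin.last j).val)) = _
    rw [Fin.val_last, Nat.sub_self, xiMat_eq_dz]
    simpa using vtx_dz_const (d := d) ϖ 1
  rw [one_smul, ← h]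
  exact lastVertex_branchesTransitively ϖ _

/-! ### The fibers of the Cartan projection -/

/-- The dominance condition needed for transitive branching persists along the flow, since the
exponents at positions `< j` only grow and the others are constant. -/
lemma biUnion_pow_flow {j : ℕ} (hj : j < d) (hj1 : 1 ≤ j) {a : Fin d → ℤ}
    (ha : ∀ k i : Fin d, k.val < j → j ≤ i.val → a i ≤ a k) (n : ℕ) :
    ⋃ σ ∈ kOrbit F d (stdCell ϖ hj a 0), (flow ϖ d j).pow n σ = kOrbit F d (stdCell ϖ hj a n) := by
  induction n with
  | zero => simp [Branching.pow]
  | succ n ih =>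
    rw [Branching.pow, biUnion_comp, ih, (flow_branchesTransitively ϖ hj hj1 a n
      fun k i hk hi => (ha k i hk hi).trans ?_).biUnion_kOrbit (flow_equivariant ϖ j)]
    · push_cast
      rfl
    · have := stdExp_monotone (j := j) a k (Int.natCast_nonneg n)
      simpa only [stdExp_zero] using this

/-- The exponents reached after the flows in dimensions at most `j`. -/
def ascentExp (x : Fin (d - 1) → ℕ) (j : ℕ) : Fin d → ℤ :=
  fun k => if k.val < j then (tailSum x k : ℤ) - tailSum x j else 0

lemma ascentExp_succ (x : Fin (d - 1) → ℕ) {j : ℕ} (hj : j < d - 1) :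
    (fun k => ascentExp x j k + if k.val < j + 1 then ((x ⟨j, hj⟩ : ℕ) : ℤ) else 0) =
      ascentExp x (j + 1) := by
  have h := tailSum_succ x hj
  funext k
  unfold ascentExp
  rcases lt_trichotomy k.val j with hk | hk | hk
  · rw [if_pos hk, if_pos (by omega), if_pos (by omega)]
    omega
  · rw [if_neg (by omega), if_pos (by omega), if_pos (by omega), hk]
    omega
  · rw [if_neg (by omega), if_neg (by omega), if_neg (by omega), add_zero]

lemma ascentExp_nonneg (x : Fin (d - 1) → ℕ) (j : ℕ) (k : Fin d) : 0 ≤ ascentExp x j k := by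
  unfold ascentExp
  split_ifs with h
  · have := tailSum_antitone x h.le
    omega
  · exact le_rfl

/-- The exponents `ascentExp x 0` vanish, so the standard vertex is `ξ`, and its `K`-orbit is a
single point. -/
lemma vertexCell_xi (hd : 0 < d) (x : Fin (d - 1) → ℕ) :
    vertexCell ϖ d (xi F d) = kOrbit F d (stdCell ϖ hd (ascentExp x 0) 0) := by
  have h0 : ∀ i, (stdCell ϖ hd (ascentExp x 0) 0).1 i = xi F d := fun i => by
    change vtx (dz ϖ _) = _
    rw [show stdExp 0 (ascentExp x 0) (0 - ((0 : ℕ) : ℤ) + (i.val : ℤ)) = fun _ => 0 by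
      funext k
      simp [stdExp, ascentExp]]
    exact vtx_dz_const ϖ 0
  ext σ
  constructor
  · intro hσ
    refine ⟨1, ?_⟩
    change intPGL 1 • stdCell ϖ hd (ascentExp x 0) 0 = σ
    rw [intPGL_one, one_smul]
    refine Subtype.ext (funext fun i => ?_)
    rw [h0, Subsingleton.elim (α := Fin 1) i 0]
    exact hσ.symm
  · rintro ⟨k, rfl⟩
    change intPGL k • (stdCell ϖ hd (ascentExp x 0) 0).1 0 = xi F d
    rw [h0, ← vtx_dz_const ϖ 0]
    refine intPGL_smul_vtx_dz ϖ k _ ((lattice_mul_dz_le_dz ϖ _ _ _).2 fun r s => ?_)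
    simpa using map_integral k r s

lemma biUnion_ascent (x : Fin (d - 1) → ℕ) (hd : 0 < d) {j : ℕ} (hj : j < d) :
    ⋃ σ ∈ kOrbit F d (stdCell ϖ hd (ascentExp x 0) 0), ascent ϖ d x j hj σ =
      kOrbit F d (stdCell ϖ hj (ascentExp x j) 0) := by
  induction j with
  | zero => simp [ascent]
  | succ j ih =>
    have h0 : ∀ i : Fin d, j ≤ i.val → ascentExp x j i = 0 := fun i hi => if_neg (by omega)
    rw [ascent, biUnion_comp, biUnion_comp, ih, (raise_branchesTransitively ϖ hj _ 0
      h0).biUnion_kOrbit (raise_equivariant ϖ j), biUnion_pow_flow ϖ hj (by omega)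
      (fun k i _ hi => by rw [h0 i (by omega)]; exact ascentExp_nonneg x j k)]
    congr 1
    -- The number of flow steps is a multiple of the period `j + 1`, so the cell reached is a
    -- time-`0` cell for the exponents `ascentExp x (j + 1)`.
    refine Subtype.ext (funext fun i => ?_)
    change vtx (dz ϖ _) = vtx (dz ϖ _)
    rw [← ascentExp_succ x (by omega), ← stdExp_add_mul_period]
    congr 3
    push_cast
    ring

lemma fiberOp_xi (hd : 2 ≤ d) (x : Fin (d - 1) → ℕ) :
    fiberOp ϖ d hd x (xi F d) = kOrbit F d (sectorVertex ϖ d x) := by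
  change ⋃ b ∈ ⋃ a ∈ vertexCell ϖ d (xi F d), ascent ϖ d x (d - 1) _ a, lastVertex ϖ d (d - 1) b = _
  rw [vertexCell_xi ϖ (by omega) x, biUnion_ascent, (lastVertex_branchesTransitively ϖ
    _).biUnion_kOrbit (lastVertex_equivariant ϖ _), sectorVertex_eq]
  congr 1
  change vtx (dz ϖ _) = _
  rw [Fin.val_last, sub_add_cancel, stdExp_zero]
  congr 2
  funext k
  unfold ascentExp
  -- At `j = d - 1` the subtracted tail is empty, and so is the tail at the last position, where
  -- `ascentExp` takes the value `0`.
  rw [tailSum_eq_zero x le_rfl]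
  split_ifs with h
  · simp
  · rw [tailSum_eq_zero x (not_lt.1 h), Nat.cast_zero]

end LocalField

end BruhatTits

theorem proposition4p2 {F : Type*} [Field F] [ValuativeRel F] [TopologicalSpace F]
    [IsNonarchimedeanLocalField F] (ϖ : BruhatTits.Uniformizer F) (d : ℕ) (hd : 2 ≤ d) :
    -- `Φ` is well defined: `x ↦ K · (sector vertex of x)` identifies `ℕ^{d-1}` with `K\ℬ⁰`
    Function.Bijective (BruhatTits.sectorOrbit ϖ d) ∧
    -- the fiber of `Φ` over `x` is `T_x(ξ)`
    (∀ x : Fin (d - 1) → ℕ,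
      BruhatTits.cartanProj ϖ d ⁻¹' {x} = BruhatTits.fiberOp ϖ d hd x (BruhatTits.xi F d)) ∧
    -- `ℬ₁ʲ = Gσʲ`, so that Hecke operators of double cosets are defined on all of `ℬ₁ʲ`
    (∀ (j : ℕ) (hj : j < d),
      MulAction.orbit (BruhatTits.PGL F d) (BruhatTits.baseCell ϖ d j hj) = Set.univ) ∧
    -- `T_j` is the Hecke operator of `P_j w_j P_j`
    (∀ (j : ℕ) (hj : j < d), 1 ≤ j →
      BruhatTits.flow ϖ d j =
        BruhatTits.hecke (BruhatTits.baseCell ϖ d j hj) (BruhatTits.w ϖ d j hj)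
          (BruhatTits.baseCell ϖ d j hj)) ∧
    -- `T_{j,j+1}` is the Hecke operator of `P_j P_{j+1}`
    (∀ (j : ℕ) (hj : j + 1 < d),
      BruhatTits.raise ϖ d j =
        BruhatTits.hecke (BruhatTits.baseCell ϖ d j (by omega)) (1 : BruhatTits.PGL F d)
          (BruhatTits.baseCell ϖ d (j + 1) hj)) ∧
    -- `T_{d-1,0}` is the Hecke operator of `P_{d-1} P_0`
    BruhatTits.lastVertex ϖ d (d - 1) =
      BruhatTits.hecke (BruhatTits.baseCell ϖ d (d - 1) (by omega)) (1 : BruhatTits.PGL F d)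
        (BruhatTits.xi F d) := by
  refine ⟨⟨BruhatTits.sectorOrbit_injective ϖ hd, BruhatTits.sectorOrbit_surjective ϖ hd⟩,
    fun x => ?_, fun j hj => BruhatTits.orbit_baseCell ϖ hj,
    fun j hj hj1 => BruhatTits.flow_eq_hecke ϖ hj hj1, fun j hj => BruhatTits.raise_eq_hecke ϖ hj,
    BruhatTits.lastVertex_eq_hecke ϖ _⟩
  rw [BruhatTits.cartanProj_preimage ϖ hd, BruhatTits.fiberOp_xi]
  ext v
  exact exists_congr fun k => eq_comm
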